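/- Write $\langle v\rangle=\sqrt{1+|v|^2}$ for $v\in\mathbb R^3$, $r=|x|$ for $x\in\mathbb R^3$; $C^k$ on a set with boundary means $C^k$ up to the boundary, with one-sided derivatives there. For a spherically symmetric density $f(x,v)\ge 0$ (that is, $f(Ax,Av)=f(x,v)$ for $A\in \mathrm{SO}(3)$) put, as functions of $r$, $$\rho=\int\langle v\rangle f\,dv,\qquad p=\int\Bigl(\frac{x\cdot v}{r}\Bigr)^2 f\,\frac{dv}{\langle v\rangle},\qquad j=\int\frac{x\cdot v}{r}f\,dv,$$ and, for functions $a,\beta$ of $r$, $$A(r)=1-\frac{8\pi}{r}\int_0^r(\rho-a\beta j)(s)\,s^2\,ds .$$ Initial data. Let $\mathring f\in C^1_c(\mathbb R^6)$ be nonnegative and spherically symmetric, $\mathring a\in C^1([0,\infty[)$ and $\mathring\beta\in C^2([0,\infty[)$ with $\mathring a>0$, $\mathring a(0)=1=\lim_{r\to\infty}\mathring a(r)$, $\mathring a'(0)=0$, $\mathring\beta(0)=\mathring\beta''(0)=0=\lim_{r\to\infty}\mathring\beta(r)$, and $\mathring A=\mathring a^{-2}-\mathring\beta^2$ on $[0,\infty[$,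 where $\mathring A$ is the function $A$ formed with $\mathring f,\mathring a,\mathring\beta$. Solution. Let $0<T\le\infty$ and let $(f,a,\beta)$ be a regular solution on $[0,T[$, with initial values $(\mathring f,\mathring a,\mathring\beta)$ at $t=0$, of the reduced spherically symmetric Einstein--Vlasov system in Painlevé--Gullstrand coordinates $$\partial_t f+\Bigl(\frac{v}{a\langle v\rangle}-\beta\frac xr\Bigr)\cdot\partial_x f+\Bigl[4\pi r\,a\,j\,\frac{x\cdot v}{r}\frac xr+\Bigl(\partial_r\beta-\frac\beta r\Bigr)\frac{x\cdot v}{r}\frac xr+\frac\beta r v\Bigr]\cdot\partial_v f=0,$$ $$\partial_t\beta-\beta\,\partial_r\beta=\frac1{2r}(1-A)+4\pi r p,\qquad \partial_t a-\beta\,\partial_r a=-4\pi r a^2 j,$$ where $\rho,p,j,A$ are formed with $f(t),a(t),\beta(t)$. Here regular means: $f\ge0$, $f\in C^1([0,T[\times\mathbb R^6)$, $f(t)$ is spherically symmetric and $\mathrm{supp}\,f(t)$ is compact locally uniformly in $t$; $a>0$, $a\in C^1([0,T[\times[0,\infty[)$, $a(t,0)=1$, $\partial_r a(t,0)=0$;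 $\beta,\partial_r\beta\in C^1([0,T[\times[0,\infty[)$, $\beta(t,0)=\partial_r^2\beta(t,0)=0$. If in addition $\mathring a\in C^2([0,\infty[)$, then $a\in C^2([0,T[\times[0,\infty[)$; moreover $\beta\in C^2([0,T[\times[0,\infty[)$, so that $a$ is as regular as $\beta$. -/

import Mathlib

open Set Filter Topology MeasureTheory

noncomputable section

namespace EinsteinVlasov

/-- Euclidean three-space. -/
abbrev E3 := EuclideanSpace ℝ (Fin 3)

/-- A unit vector, used to read a spherically symmetric function of `x` as a function of `r`. -/
def e₁ : E3 := EuclideanSpace.single 0 1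

/-- `⟨v⟩ = √(1 + |v|²)`. -/
def bracket (v : E3) : ℝ := Real.sqrt (1 + ‖v‖ ^ 2)

/-- The time interval `[0, T[`, where `T ∈ ]0, ∞]`. -/
def timeInterval (T : EReal) : Set ℝ := {t | 0 ≤ t ∧ (t : EReal) < T}

/-- `g` is `C^n` on `I × [0, ∞[`, with one-sided derivatives at the boundary. -/
def SmoothTR (n : ℕ) (I : Set ℝ) (g : ℝ → ℝ → ℝ) : Prop :=
  ContDiffOn ℝ n (fun q : ℝ × ℝ => g q.1 q.2) (I ×ˢ Ici (0 : ℝ))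

/-- `∂_t g (t, r)`, for `g` on `I × [0, ∞[`. -/
def dt (I : Set ℝ) (g : ℝ → ℝ → ℝ) (t r : ℝ) : ℝ := derivWithin (fun s => g s r) I t

/-- `∂_r g (t, r)`, for `g` on `I × [0, ∞[`. -/
def dr (g : ℝ → ℝ → ℝ) (t r : ℝ) : ℝ := derivWithin (g t) (Ici (0 : ℝ)) r

/-- Spherical symmetry of a function on phase space: `h (A x, A v) = h (x, v)`, `A ∈ SO(3)`. -/
def SphericallySymmetric (h : E3 → E3 → ℝ) : Prop :=
  ∀ A ∈ Matrix.specialOrthogonalGroup (Fin 3) ℝ, ∀ x v : E3,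
    h (Matrix.toEuclideanLin A x) (Matrix.toEuclideanLin A v) = h x v

/-! Matter terms of a phase space density `h = h (x, v)`, as functions of `x ≠ 0`. -/

def rhoCart (h : E3 → E3 → ℝ) (x : E3) : ℝ := ∫ v, bracket v * h x v

def pCart (h : E3 → E3 → ℝ) (x : E3) : ℝ :=
  ∫ v, (inner ℝ x v / ‖x‖) ^ 2 * h x v / bracket v

def jCart (h : E3 → E3 → ℝ) (x : E3) : ℝ := ∫ v, inner ℝ x v / ‖x‖ * h x v

/-! The same matter terms as functions of `r = |x|`; the densities of interest are spherically
symmetric, so that the choice of the direction of `x` is immaterial. Below, the values of `p` and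
`j` at `r = 0` enter only multiplied by `r`, or under an integral. -/

def rho (h : E3 → E3 → ℝ) (r : ℝ) : ℝ := rhoCart h (r • e₁)

def p (h : E3 → E3 → ℝ) (r : ℝ) : ℝ := pCart h (r • e₁)

def j (h : E3 → E3 → ℝ) (r : ℝ) : ℝ := jCart h (r • e₁)

/-- `A (r) = 1 - (8 π / r) ∫_0^r (ρ - a β j)(s) s² ds`, at a fixed time. -/
def capA (h : E3 → E3 → ℝ) (a b : ℝ → ℝ) (r : ℝ) : ℝ :=
  1 - 8 * Real.pi / r * ∫ s in (0 : ℝ)..r, (rho h s - a s * b s * j h s) * s ^ 2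

/-- Admissible initial data. -/
structure IsAdmissibleData (f₀ : E3 → E3 → ℝ) (a₀ b₀ : ℝ → ℝ) : Prop where
  f_contDiff : ContDiff ℝ 1 (fun z : E3 × E3 => f₀ z.1 z.2)
  f_compact : HasCompactSupport (fun z : E3 × E3 => f₀ z.1 z.2)
  f_symm : SphericallySymmetric f₀
  f_nonneg : ∀ x v, 0 ≤ f₀ x v
  a_contDiff : ContDiffOn ℝ 1 a₀ (Ici 0)
  a_zero : a₀ 0 = 1
  a_infty : Tendsto a₀ atTop (𝓝 1)
  a_deriv_zero : derivWithin a₀ (Ici 0) 0 = 0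
  a_pos : ∀ r, 0 ≤ r → 0 < a₀ r
  b_contDiff : ContDiffOn ℝ 2 b₀ (Ici 0)
  b_zero : b₀ 0 = 0
  b_deriv2_zero : iteratedDerivWithin 2 b₀ (Ici 0) 0 = 0
  b_infty : Tendsto b₀ atTop (𝓝 0)
  constraint : ∀ r, 0 ≤ r → capA f₀ a₀ b₀ r = 1 / a₀ r ^ 2 - b₀ r ^ 2

/-- Regularity of the phase space density on the time interval `I`. -/
structure IsRegularF (I : Set ℝ) (f : ℝ → E3 → E3 → ℝ) : Prop where
  nonneg : ∀ t ∈ I, ∀ x v, 0 ≤ f t x v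
  contDiff : ContDiffOn ℝ 1 (fun q : ℝ × E3 × E3 => f q.1 q.2.1 q.2.2) (I ×ˢ univ)
  symm : ∀ t ∈ I, SphericallySymmetric (f t)
  /-- The support of `f t` is compact, locally uniformly in `t ∈ I`. -/
  compact : ∀ J : Set ℝ, J ⊆ I → IsCompact J → ∃ K : Set (E3 × E3), IsCompact K ∧
    ∀ t ∈ J, ∀ x v, (x, v) ∉ K → f t x v = 0

/-- Regularity of the metric coefficient `a` on `I × [0, ∞[`. -/
structure IsRegularA (I : Set ℝ) (a : ℝ → ℝ → ℝ) : Prop where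
  pos : ∀ t ∈ I, ∀ r, 0 ≤ r → 0 < a t r
  contDiff : SmoothTR 1 I a
  center : ∀ t ∈ I, a t 0 = 1
  deriv_center : ∀ t ∈ I, dr a t 0 = 0

/-- Regularity of the metric coefficient `β` on `I × [0, ∞[`. -/
structure IsRegularB (I : Set ℝ) (b : ℝ → ℝ → ℝ) : Prop where
  contDiff : SmoothTR 1 I b
  contDiff_dr : SmoothTR 1 I (dr b)
  center : ∀ t ∈ I, b t 0 = 0
  deriv2_center : ∀ t ∈ I, dr (dr b) t 0 = 0

/-- The coefficient of `∂_x f` in the Vlasov equation, for `x ≠ 0`. -/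
def F1 (a b : ℝ → ℝ → ℝ) (t : ℝ) (x v : E3) : E3 :=
  (1 / (a t ‖x‖ * bracket v)) • v - (b t ‖x‖ / ‖x‖) • x

/-- The coefficient of `∂_v f` in the Vlasov equation, for `x ≠ 0`. -/
def F2 (f : ℝ → E3 → E3 → ℝ) (a b : ℝ → ℝ → ℝ) (t : ℝ) (x v : E3) : E3 :=
  (4 * Real.pi * ‖x‖ * a t ‖x‖ * j (f t) ‖x‖ * (inner ℝ x v / ‖x‖) / ‖x‖) • x
    + ((dr b t ‖x‖ - b t ‖x‖ / ‖x‖) * (inner ℝ x v / ‖x‖) / ‖x‖) • x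
    + (b t ‖x‖ / ‖x‖) • v

/-- `(f, a, β)` is a regular solution on the time interval `[0, T[` of the reduced
Einstein-Vlasov system in Painlevé-Gullstrand coordinates, with initial data `(f₀, a₀, b₀)`.
The equations whose coefficients are singular at the center are required away from it, where they
extend by continuity. -/
structure IsRegularSolution (T : EReal) (f₀ : E3 → E3 → ℝ) (a₀ b₀ : ℝ → ℝ)
    (f : ℝ → E3 → E3 → ℝ) (a b : ℝ → ℝ → ℝ) : Prop where
  regular_f : IsRegularF (timeInterval T) f
  regular_a : IsRegularA (timeInterval T) a
  regular_b : IsRegularB (timeInterval T) b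
  init_f : ∀ x v, f 0 x v = f₀ x v
  init_a : ∀ r, 0 ≤ r → a 0 r = a₀ r
  init_b : ∀ r, 0 ≤ r → b 0 r = b₀ r
  vlasov : ∀ t ∈ timeInterval T, ∀ x v : E3, x ≠ 0 →
    derivWithin (fun s => f s x v) (timeInterval T) t
      + fderiv ℝ (fun y => f t y v) x (F1 a b t x v)
      + fderiv ℝ (fun w => f t x w) v (F2 f a b t x v) = 0
  eq_b : ∀ t ∈ timeInterval T, ∀ r, 0 < r →
    dt (timeInterval T) b t r - b t r * dr b t r
      = 1 / (2 * r) * (1 - capA (f t) (a t) (b t) r) + 4 * Real.pi * r * p (f t) r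
  eq_a : ∀ t ∈ timeInterval T, ∀ r, 0 ≤ r →
    dt (timeInterval T) a t r - b t r * dr a t r
      = -(4 * Real.pi * r * a t r ^ 2 * j (f t) r)

end EinsteinVlasov

end

namespace EinsteinVlasov

/-! ### Parametric integrals over compact sets -/

section ParametricIntegral

variable {P Y : Type*} [TopologicalSpace P] [TopologicalSpace Y]

theorem exists_bound_nhdsWithin {F : P → Y → ℝ} {S : Set P} {K : Set Y} (hK : IsCompact K)
    (hF : ContinuousOn (fun q : P × Y => F q.1 q.2) (S ×ˢ K)) {p₀ : P} (hp : p₀ ∈ S) :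
    ∃ C, ∀ᶠ q in 𝓝[S] p₀, ∀ x ∈ K, ‖F q x‖ ≤ C := by
  have key : ∃ C, ∀ᶠ q in 𝓝[S] p₀, ∀ x ∈ K, x ∈ K → ‖F q x‖ ≤ C := by
    refine hK.induction_on (p := fun s => ∃ C, ∀ᶠ q in 𝓝[S] p₀, ∀ x ∈ s, x ∈ K → ‖F q x‖ ≤ C)
      ⟨0, by simp⟩ ?_ ?_ ?_
    · rintro s t hst ⟨C, hC⟩
      exact ⟨C, hC.mono fun q hq x hx => hq x (hst hx)⟩
    · rintro s t ⟨C, hC⟩ ⟨C', hC'⟩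
      refine ⟨max C C', ?_⟩
      filter_upwards [hC, hC'] with q h h' x hx hxK
      rcases hx with hx | hx
      · exact (h x hx hxK).trans (le_max_left _ _)
      · exact (h' x hx hxK).trans (le_max_right _ _)
    · intro x hx
      have h := (hF (p₀, x) ⟨hp, hx⟩).norm.eventually_lt_const (lt_add_one _)
      rw [nhdsWithin_prod_eq, eventually_prod_iff] at h
      obtain ⟨pa, ha, pb, hb, h⟩ := h
      refine ⟨{y | pb y}, hb, ‖F p₀ x‖ + 1, ?_⟩
      filter_upwards [ha] with q hq y hy _
      exact (h hq hy).le
  obtain ⟨C, hC⟩ := key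
  exact ⟨C, hC.mono fun q hq x hx => hq x hx hx⟩

variable [MeasurableSpace Y] [OpensMeasurableSpace Y] [T2Space Y]
  {μ : Measure Y} [IsFiniteMeasureOnCompacts μ]

theorem integrableOn_slice {F : P → Y → ℝ} {S : Set P} {K : Set Y} (hK : IsCompact K)
    (hF : ContinuousOn (fun q : P × Y => F q.1 q.2) (S ×ˢ K)) {q : P} (hq : q ∈ S) :
    IntegrableOn (F q) K μ := by
  refine ContinuousOn.integrableOn_compact' hK hK.isClosed.measurableSet ?_
  exact hF.comp (f := fun y => (q, y)) (by fun_prop) (fun y hy => ⟨hq, hy⟩)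

theorem continuousOn_setIntegral [FirstCountableTopology P] {F : P → Y → ℝ} {S : Set P} {K : Set Y}
    (hK : IsCompact K) (hF : ContinuousOn (fun q : P × Y => F q.1 q.2) (S ×ˢ K)) :
    ContinuousOn (fun q => ∫ y in K, F q y ∂μ) S := by
  intro p₀ hp
  obtain ⟨C, hC⟩ := exists_bound_nhdsWithin hK hF hp
  have hKm := hK.isClosed.measurableSet
  refine continuousWithinAt_of_dominated (bound := fun _ => C) ?_ ?_ ?_ ?_
  · filter_upwards [self_mem_nhdsWithin] with q hq
    exact (integrableOn_slice hK hF hq).aestronglyMeasurable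
  · filter_upwards [hC] with q hq
    exact (ae_restrict_iff' hKm).2 (Eventually.of_forall fun x hx => hq x hx)
  · exact integrableOn_const hK.measure_ne_top
  · refine (ae_restrict_iff' hKm).2 (Eventually.of_forall fun x hx => ?_)
    exact (hF (p₀, x) ⟨hp, hx⟩).comp (f := fun q => (q, x)) (by fun_prop) (fun q hq => ⟨hq, hx⟩)

theorem hasDerivWithinAt_setIntegral {F F' : ℝ → Y → ℝ} {J : Set ℝ} {K : Set Y} (hK : IsCompact K)
    (hJ : Convex ℝ J) (hF : ContinuousOn (fun q : ℝ × Y => F q.1 q.2) (J ×ˢ K))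
    (hF' : ContinuousOn (fun q : ℝ × Y => F' q.1 q.2) (J ×ˢ K))
    (hd : ∀ t ∈ J, ∀ y ∈ K, HasDerivWithinAt (fun s => F s y) (F' t y) J t) {t : ℝ} (ht : t ∈ J) :
    HasDerivWithinAt (fun s => ∫ y in K, F s y ∂μ) (∫ y in K, F' t y ∂μ) J t := by
  obtain ⟨C, hC⟩ := exists_bound_nhdsWithin hK hF' ht
  have hKm := hK.isClosed.measurableSet
  obtain ⟨δ, hδ, hball⟩ := Metric.mem_nhdsWithin_iff.1 hC
  have hconv : Convex ℝ (Metric.ball t δ ∩ J) := (convex_ball t δ).inter hJ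
  have hlip : ∀ s ∈ Metric.ball t δ ∩ J, ∀ y ∈ K, ‖F s y - F t y‖ ≤ C * ‖s - t‖ := by
    intro s hs y hy
    exact hconv.norm_image_sub_le_of_norm_hasDerivWithin_le (f := fun s => F s y)
      (f' := fun s => F' s y)
      (fun x hx => (hd x hx.2 y hy).mono inter_subset_right) (fun x hx => hball hx y hy)
      ⟨Metric.mem_ball_self hδ, ht⟩ hs
  rw [hasDerivWithinAt_iff_tendsto_slope]
  have hmem : Metric.ball t δ ∩ J ∈ 𝓝[J \ {t}] t :=
    nhdsWithin_mono t sdiff_subset (Metric.mem_nhdsWithin_iff.2 ⟨δ, hδ, subset_rfl⟩)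
  have heq : (fun s => ∫ y in K, slope (fun s => F s y) t s ∂μ)
      =ᶠ[𝓝[J \ {t}] t] slope (fun s => ∫ y in K, F s y ∂μ) t := by
    filter_upwards [hmem] with s hs
    simp only [slope_def_field]
    rw [integral_div, integral_sub (integrableOn_slice hK hF hs.2) (integrableOn_slice hK hF ht)]
  refine Tendsto.congr' heq ?_
  refine tendsto_integral_filter_of_dominated_convergence (fun _ => C) ?_ ?_ ?_ ?_
  · filter_upwards [hmem] with s hs
    simp only [slope_def_field]
    exact (((integrableOn_slice hK hF hs.2).sub
      (integrableOn_slice hK hF ht)).div_const _).aestronglyMeasurable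
  · filter_upwards [hmem, self_mem_nhdsWithin] with s hs hst
    refine (ae_restrict_iff' hKm).2 (Eventually.of_forall fun y hy => ?_)
    rw [slope_def_field, norm_div]
    have : 0 < ‖s - t‖ := norm_pos_iff.2 (sub_ne_zero.2 hst.2)
    exact (div_le_iff₀ this).2 (hlip s hs y hy)
  · exact integrableOn_const hK.measure_ne_top
  · refine (ae_restrict_iff' hKm).2 (Eventually.of_forall fun y hy => ?_)
    exact hasDerivWithinAt_iff_tendsto_slope.1 (hd t ht y hy)

end ParametricIntegral

theorem add_mul_sub_mem {J : Set ℝ} (hJ : Convex ℝ J) {s t σ : ℝ} (hs : s ∈ J) (ht : t ∈ J)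
    (hσ : σ ∈ Icc (0 : ℝ) 1) : s + (t - s) * σ ∈ J := by
  have := hJ.add_smul_sub_mem hs ht hσ
  simpa [mul_comm] using this

theorem intervalIntegral_eq_mul_setIntegral (g : ℝ → ℝ) (s t : ℝ) :
    ∫ τ in s..t, g τ = (t - s) * ∫ σ in Icc (0 : ℝ) 1, g (s + (t - s) * σ) := by
  rw [integral_Icc_eq_integral_Ioc, ← intervalIntegral.integral_of_le zero_le_one,
    intervalIntegral.mul_integral_comp_add_mul]
  simp

theorem continuousOn_intervalIntegral_param {P : Type*} [TopologicalSpace P]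
    [FirstCountableTopology P] {Ψ : ℝ → P → ℝ} {J : Set ℝ} {S : Set P} (hJ : Convex ℝ J)
    (hΨ : ContinuousOn (fun q : ℝ × P => Ψ q.1 q.2) (J ×ˢ S)) :
    ContinuousOn (fun q : ℝ × ℝ × P => ∫ τ in q.1..q.2.1, Ψ τ q.2.2) (J ×ˢ J ×ˢ S) := by
  have h : (fun q : ℝ × ℝ × P => ∫ τ in q.1..q.2.1, Ψ τ q.2.2) = fun q =>
      (q.2.1 - q.1) * ∫ σ in Icc (0 : ℝ) 1, Ψ (q.1 + (q.2.1 - q.1) * σ) q.2.2 := by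
    funext q
    exact intervalIntegral_eq_mul_setIntegral _ _ _
  rw [h]
  refine ContinuousOn.mul (by fun_prop) ?_
  refine continuousOn_setIntegral
    (F := fun (q : ℝ × ℝ × P) σ => Ψ (q.1 + (q.2.1 - q.1) * σ) q.2.2) isCompact_Icc ?_
  refine hΨ.comp (f := fun z : (ℝ × ℝ × P) × ℝ =>
    (z.1.1 + (z.1.2.1 - z.1.1) * z.2, z.1.2.2)) (by fun_prop) ?_
  rintro ⟨⟨s, t, q⟩, σ⟩ ⟨⟨hs, ht, hq⟩, hσ⟩
  exact ⟨add_mul_sub_mem hJ hs ht hσ, hq⟩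

/-! ### Partial derivatives on products of intervals -/

/-- `g` has the continuous partial derivatives `gt` and `gr` on `J × R`. -/
structure HasPartials (J R : Set ℝ) (g gt gr : ℝ → ℝ → ℝ) : Prop where
  left : ∀ t ∈ J, ∀ r ∈ R, HasDerivWithinAt (fun s => g s r) (gt t r) J t
  right : ∀ t ∈ J, ∀ r ∈ R, HasDerivWithinAt (g t) (gr t r) R r
  cont_left : ContinuousOn (fun q : ℝ × ℝ => gt q.1 q.2) (J ×ˢ R)
  cont_right : ContinuousOn (fun q : ℝ × ℝ => gr q.1 q.2) (J ×ˢ R)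

section Partials

variable {J R : Set ℝ} {g gt gr : ℝ → ℝ → ℝ}

theorem norm_sub_sub_le_of_hasDerivWithinAt {φ φ' : ℝ → ℝ} {s : Set ℝ} (hs : Convex ℝ s)
    (h : ∀ x ∈ s, HasDerivWithinAt φ (φ' x) s x) {c ε : ℝ} (hb : ∀ x ∈ s, ‖φ' x - c‖ ≤ ε)
    {x y : ℝ} (hx : x ∈ s) (hy : y ∈ s) : ‖φ y - φ x - c * (y - x)‖ ≤ ε * ‖y - x‖ := by
  have := hs.norm_image_sub_le_of_norm_hasDerivWithin_le (f := fun z => φ z - c * z)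
    (f' := fun z => φ' z - c) (C := ε)
    (fun z hz => by
      simpa using HasDerivWithinAt.fun_sub (h z hz) ((hasDerivWithinAt_id z s).const_mul c))
    hb hx hy
  have e : φ y - φ x - c * (y - x) = φ y - c * y - (φ x - c * x) := by ring
  rwa [e]

theorem HasPartials.hasFDerivWithinAt (h : HasPartials J R g gt gr) (hJ : Convex ℝ J)
    (hR : Convex ℝ R) {t r : ℝ} (ht : t ∈ J) (hr : r ∈ R) :
    HasFDerivWithinAt (fun q : ℝ × ℝ => g q.1 q.2)
      (gt t r • ContinuousLinearMap.fst ℝ ℝ ℝ + gr t r • ContinuousLinearMap.snd ℝ ℝ ℝ)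
      (J ×ˢ R) (t, r) := by
  rw [hasFDerivWithinAt_iff_isLittleO, Asymptotics.isLittleO_iff]
  intro ε hε
  have h1 := Metric.continuousWithinAt_iff.1 (h.cont_left (t, r) ⟨ht, hr⟩) (ε / 2) (by positivity)
  have h2 := Metric.continuousWithinAt_iff.1 (h.cont_right (t, r) ⟨ht, hr⟩) (ε / 2) (by positivity)
  obtain ⟨δ₁, hδ₁, h1⟩ := h1
  obtain ⟨δ₂, hδ₂, h2⟩ := h2
  have hδ : 0 < min δ₁ δ₂ := lt_min hδ₁ hδ₂
  refine Metric.mem_nhdsWithin_iff.2 ⟨min δ₁ δ₂, hδ, ?_⟩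
  rintro ⟨s, y⟩ ⟨hball, hs, hy⟩
  rw [Metric.mem_ball, Prod.dist_eq, max_lt_iff] at hball
  simp only at hball hs hy
  have hct := (convex_ball t (min δ₁ δ₂)).inter hJ
  have hcr := (convex_ball r (min δ₁ δ₂)).inter hR
  have e1 := norm_sub_sub_le_of_hasDerivWithinAt (φ := fun s => g s y) (φ' := fun s => gt s y)
    (c := gt t r) (ε := ε / 2) hct
    (fun x hx => (h.left x hx.2 y hy).mono inter_subset_right)
    (fun x hx => by
      rw [← dist_eq_norm]
      refine (h1 (x := (x, y)) ⟨hx.2, hy⟩ ?_).le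
      rw [Prod.dist_eq]
      exact max_lt (hx.1.trans_le (min_le_left _ _)) (hball.2.trans_le (min_le_left _ _)))
    (x := t) (y := s) ⟨Metric.mem_ball_self hδ, ht⟩ ⟨hball.1, hs⟩
  have e2 := norm_sub_sub_le_of_hasDerivWithinAt (φ := g t) (φ' := gr t)
    (c := gr t r) (ε := ε / 2) hcr
    (fun x hx => (h.right t ht x hx.2).mono inter_subset_right)
    (fun x hx => by
      rw [← dist_eq_norm]
      refine (h2 (x := (t, x)) ⟨ht, hx.2⟩ ?_).le
      rw [Prod.dist_eq]
      exact max_lt (by simpa using hδ₂) (hx.1.trans_le (min_le_right _ _)))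
    (x := r) (y := y) ⟨Metric.mem_ball_self hδ, hr⟩ ⟨hball.2, hy⟩
  have n1 : ‖s - t‖ ≤ ‖((s, y) : ℝ × ℝ) - (t, r)‖ := norm_fst_le (((s, y) : ℝ × ℝ) - (t, r))
  have n2 : ‖y - r‖ ≤ ‖((s, y) : ℝ × ℝ) - (t, r)‖ := norm_snd_le (((s, y) : ℝ × ℝ) - (t, r))
  calc _ = ‖(g s y - g t y - gt t r * (s - t)) + (g t y - g t r - gr t r * (y - r))‖ := by
        congr 1
        simp
        ring
    _ ≤ ε / 2 * ‖s - t‖ + ε / 2 * ‖y - r‖ := (norm_add_le _ _).trans (add_le_add e1 e2)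
    _ ≤ ε / 2 * ‖((s, y) : ℝ × ℝ) - (t, r)‖ + ε / 2 * ‖((s, y) : ℝ × ℝ) - (t, r)‖ := by gcongr
    _ = _ := by ring

theorem HasPartials.continuousOn (h : HasPartials J R g gt gr) (hJ : Convex ℝ J)
    (hR : Convex ℝ R) : ContinuousOn (fun q : ℝ × ℝ => g q.1 q.2) (J ×ˢ R) :=
  fun _ hq => (h.hasFDerivWithinAt hJ hR hq.1 hq.2).continuousWithinAt

theorem HasPartials.contDiffOn {n : ℕ} (h : HasPartials J R g gt gr) (hJ : Convex ℝ J)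
    (hR : Convex ℝ R) (hJu : UniqueDiffOn ℝ J) (hRu : UniqueDiffOn ℝ R)
    (ht : ContDiffOn ℝ n (fun q : ℝ × ℝ => gt q.1 q.2) (J ×ˢ R))
    (hr : ContDiffOn ℝ n (fun q : ℝ × ℝ => gr q.1 q.2) (J ×ˢ R)) :
    ContDiffOn ℝ (n + 1 : ℕ) (fun q : ℝ × ℝ => g q.1 q.2) (J ×ˢ R) := by
  push_cast
  rw [contDiffOn_succ_iff_hasFDerivWithinAt_of_uniqueDiffOn (hJu.prod hRu)]
  refine ⟨by simp, _, ?_, fun q hq => h.hasFDerivWithinAt hJ hR hq.1 hq.2⟩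
  exact (ht.smul contDiffOn_const).add (hr.smul contDiffOn_const)

theorem HasPartials.contDiffOn_one (h : HasPartials J R g gt gr) (hJ : Convex ℝ J)
    (hR : Convex ℝ R) (hJu : UniqueDiffOn ℝ J) (hRu : UniqueDiffOn ℝ R) :
    ContDiffOn ℝ 1 (fun q : ℝ × ℝ => g q.1 q.2) (J ×ˢ R) := by
  simpa using h.contDiffOn (n := 0) hJ hR hJu hRu (by simpa using h.cont_left)
    (by simpa using h.cont_right)

theorem HasPartials.mono (h : HasPartials J R g gt gr) {J' R' : Set ℝ} (hJ : J' ⊆ J)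
    (hR : R' ⊆ R) : HasPartials J' R' g gt gr where
  left t ht r hr := (h.left t (hJ ht) r (hR hr)).mono hJ
  right t ht r hr := (h.right t (hJ ht) r (hR hr)).mono hR
  cont_left := h.cont_left.mono (prod_mono hJ hR)
  cont_right := h.cont_right.mono (prod_mono hJ hR)

theorem hasPartials_of_contDiffOn (hJu : UniqueDiffOn ℝ J) (hRu : UniqueDiffOn ℝ R)
    (hg : ContDiffOn ℝ 1 (fun q : ℝ × ℝ => g q.1 q.2) (J ×ˢ R)) :
    HasPartials J R g (fun t r => derivWithin (fun s => g s r) J t)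
      (fun t r => derivWithin (g t) R r) := by
  have hu := hJu.prod hRu
  have hd : ∀ q ∈ J ×ˢ R, HasFDerivWithinAt (fun q : ℝ × ℝ => g q.1 q.2)
      (fderivWithin ℝ (fun q : ℝ × ℝ => g q.1 q.2) (J ×ˢ R) q) (J ×ˢ R) q :=
    fun q hq => (hg.differentiableOn one_ne_zero q hq).hasFDerivWithinAt
  have hc := hg.continuousOn_fderivWithin hu le_rfl
  have hl : ∀ t ∈ J, ∀ r ∈ R, HasDerivWithinAt (fun s => g s r)
      (fderivWithin ℝ (fun q : ℝ × ℝ => g q.1 q.2) (J ×ˢ R) (t, r) (1, 0)) J t := by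
    intro t ht r hr
    have hm : MapsTo (fun s => (s, r)) J (J ×ˢ R) := fun s hs => ⟨hs, hr⟩
    exact (hd (t, r) ⟨ht, hr⟩).comp_hasDerivWithinAt t
      ((hasDerivWithinAt_id t J).prodMk (hasDerivWithinAt_const t J r)) hm
  have hr : ∀ t ∈ J, ∀ r ∈ R, HasDerivWithinAt (g t)
      (fderivWithin ℝ (fun q : ℝ × ℝ => g q.1 q.2) (J ×ˢ R) (t, r) (0, 1)) R r := by
    intro t ht r hr
    have hm : MapsTo (fun y => (t, y)) R (J ×ˢ R) := fun s hs => ⟨ht, hs⟩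
    exact (hd (t, r) ⟨ht, hr⟩).comp_hasDerivWithinAt r
      ((hasDerivWithinAt_const r R t).prodMk (hasDerivWithinAt_id r R)) hm
  refine ⟨fun t ht r h => (hl t ht r h).differentiableWithinAt.hasDerivWithinAt,
    fun t ht r h => (hr t ht r h).differentiableWithinAt.hasDerivWithinAt, ?_, ?_⟩
  · exact (hc.clm_apply continuousOn_const).congr
      fun q hq => (hl q.1 hq.1 q.2 hq.2).derivWithin (hJu q.1 hq.1)
  · exact (hc.clm_apply continuousOn_const).congr
      fun q hq => (hr q.1 hq.1 q.2 hq.2).derivWithin (hRu q.2 hq.2)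

/-- If `∂_r ∂_t g` exists and is continuous then so is `∂_t ∂_r g`, and they agree. -/
theorem HasPartials.hasDerivWithinAt_right_left {T : ℝ} {gtr : ℝ → ℝ → ℝ}
    (h : HasPartials (Icc 0 T) R g gt gr) (hT : 0 < T) (hR : Convex ℝ R) (hRu : UniqueDiffOn ℝ R)
    (hd : ∀ t ∈ Icc 0 T, ∀ r ∈ R, HasDerivWithinAt (gt t) (gtr t r) R r)
    (hc : ContinuousOn (fun q : ℝ × ℝ => gtr q.1 q.2) (Icc 0 T ×ˢ R)) {t r : ℝ}
    (ht : t ∈ Icc 0 T) (hr : r ∈ R) :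
    HasDerivWithinAt (fun s => gr s r) (gtr t r) (Icc 0 T) t := by
  have slice : ∀ {φ : ℝ → ℝ → ℝ}, ContinuousOn (fun q : ℝ × ℝ => φ q.1 q.2) (Icc 0 T ×ˢ R) →
      ∀ y ∈ R, ContinuousOn (fun s => φ s y) (Icc 0 T) := fun hφ y hy =>
    hφ.comp (f := fun s => (s, y)) (by fun_prop) (fun s hs => ⟨hs, hy⟩)
  have h0 : (0 : ℝ) ∈ Icc 0 T := ⟨le_rfl, hT.le⟩
  have repr : ∀ s ∈ Icc 0 T, ∀ y ∈ R, g s y = g 0 y + ∫ τ in Icc 0 s, gt τ y := by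
    intro s hs y hy
    have hsub : Icc 0 s ⊆ Icc 0 T := Icc_subset_Icc_right hs.2
    rw [integral_Icc_eq_integral_Ioc, ← intervalIntegral.integral_of_le hs.1,
      intervalIntegral.integral_eq_sub_of_hasDeriv_right (f := fun s => g s y)]
    · ring
    · rw [uIcc_of_le hs.1]
      exact fun τ hτ => ((h.left τ (hsub hτ) y hy).continuousWithinAt).mono hsub
    · intro τ hτ
      rw [min_eq_left hs.1, max_eq_right hs.1] at hτ
      have hτ' : τ ∈ Icc 0 T := hsub (Ioo_subset_Icc_self hτ)
      exact ((h.left τ hτ' y hy).hasDerivAt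
        (Icc_mem_nhds hτ.1 (hτ.2.trans_le hs.2))).hasDerivWithinAt
    · refine ContinuousOn.intervalIntegrable ?_
      rw [uIcc_of_le hs.1]
      exact (slice h.cont_left y hy).mono hsub
  have repr' : ∀ s ∈ Icc 0 T, gr s r = gr 0 r + ∫ τ in (0 : ℝ)..s, gtr τ r := by
    intro s hs
    have hsub : Icc 0 s ⊆ Icc 0 T := Icc_subset_Icc_right hs.2
    have hswap : MapsTo (fun q : ℝ × ℝ => (q.2, q.1)) (R ×ˢ Icc 0 s) (Icc 0 T ×ˢ R) :=
      fun q hq => ⟨hsub hq.2, hq.1⟩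
    have hd1 : HasDerivWithinAt (fun y => g 0 y + ∫ τ in Icc 0 s, gt τ y)
        (gr 0 r + ∫ τ in Icc 0 s, gtr τ r) R r := by
      refine (h.right 0 h0 r hr).add ?_
      exact hasDerivWithinAt_setIntegral (F := fun y τ => gt τ y) (F' := fun y τ => gtr τ y)
        isCompact_Icc hR (h.cont_left.comp (by fun_prop) hswap) (hc.comp (by fun_prop) hswap)
        (fun y hy τ hτ => hd τ (hsub hτ) y hy) hr
    have hd2 := (h.right s hs r hr).congr (fun y hy => (repr s hs y hy).symm)
      (repr s hs r hr).symm
    have := (hRu r hr).eq_deriv _ hd2 hd1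
    rw [this, intervalIntegral.integral_of_le hs.1, integral_Icc_eq_integral_Ioc]
  have hcr := slice hc r hr
  have : HasDerivWithinAt (fun s => gr 0 r + ∫ τ in (0 : ℝ)..s, gtr τ r) (gtr t r) (Icc 0 T) t := by
    refine HasDerivWithinAt.const_add _ ?_
    have : Fact (t ∈ Icc 0 T) := ⟨ht⟩
    refine intervalIntegral.integral_hasDerivWithinAt_right ?_ ?_ (hcr t ht)
    · refine ContinuousOn.intervalIntegrable ?_
      rw [uIcc_of_le ht.1]
      exact hcr.mono (Icc_subset_Icc_right ht.2)
    · exact hcr.stronglyMeasurableAtFilter_nhdsWithin measurableSet_Icc t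
  exact this.congr repr' (repr' t ht)

end Partials

/-! ### Calculus on an interval -/

theorem hasDerivWithinAt_integral_right {ψ : ℝ → ℝ} {c d e t : ℝ} (hψ : ContinuousOn ψ (Icc c d))
    (he : e ∈ Icc c d) (ht : t ∈ Icc c d) :
    HasDerivWithinAt (fun s => ∫ τ in e..s, ψ τ) (ψ t) (Icc c d) t := by
  have : Fact (t ∈ Icc c d) := ⟨ht⟩
  refine intervalIntegral.integral_hasDerivWithinAt_right ?_ ?_ (hψ t ht)
  · exact (hψ.mono (uIcc_subset_Icc he ht)).intervalIntegrable
  · exact hψ.stronglyMeasurableAtFilter_nhdsWithin measurableSet_Icc t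

theorem hasDerivWithinAt_integral_left {ψ : ℝ → ℝ} {c d e t : ℝ} (hψ : ContinuousOn ψ (Icc c d))
    (he : e ∈ Icc c d) (ht : t ∈ Icc c d) :
    HasDerivWithinAt (fun s => ∫ τ in s..e, ψ τ) (-ψ t) (Icc c d) t := by
  have h := HasDerivWithinAt.fun_neg (hasDerivWithinAt_integral_right hψ he ht)
  refine h.congr (fun s _ => ?_) ?_ <;> exact intervalIntegral.integral_symm _ _

theorem setIntegral_Icc_eq_sub {φ φ' : ℝ → ℝ} {c d : ℝ} (hcd : c ≤ d)
    (h : ∀ t ∈ Icc c d, HasDerivWithinAt φ (φ' t) (Icc c d) t) (hc : ContinuousOn φ' (Icc c d)) :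
    ∫ τ in Icc c d, φ' τ = φ d - φ c := by
  rw [integral_Icc_eq_integral_Ioc, ← intervalIntegral.integral_of_le hcd]
  refine intervalIntegral.integral_eq_sub_of_hasDeriv_right ?_ ?_ ?_
  · rw [uIcc_of_le hcd]
    exact fun t ht => (h t ht).continuousWithinAt
  · intro t ht
    rw [min_eq_left hcd, max_eq_right hcd] at ht
    exact ((h t (Ioo_subset_Icc_self ht)).hasDerivAt (Icc_mem_nhds ht.1 ht.2)).hasDerivWithinAt
  · refine ContinuousOn.intervalIntegrable ?_
    rwa [uIcc_of_le hcd]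

theorem sub_eq_mul_setIntegral_deriv {φ φ' : ℝ → ℝ}
    (h : ∀ y ∈ Ici (0 : ℝ), HasDerivWithinAt φ (φ' y) (Ici 0) y)
    (hc : ContinuousOn φ' (Ici 0)) {y z : ℝ} (hy : 0 ≤ y) (hz : 0 ≤ z) :
    φ z - φ y = (z - y) * ∫ σ in Icc (0 : ℝ) 1, φ' (y + (z - y) * σ) := by
  rw [← intervalIntegral_eq_mul_setIntegral φ' y z]
  have hsub : uIcc y z ⊆ Ici 0 := fun x hx => (le_min hy hz).trans hx.1
  refine (intervalIntegral.integral_eq_sub_of_hasDeriv_right ?_ ?_ ?_).symm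
  · exact fun x hx => (h x (hsub hx)).continuousWithinAt.mono hsub
  · intro x hx
    have hx0 : 0 < x := (le_min hy hz).trans_lt hx.1
    exact ((h x hx0.le).hasDerivAt (Ici_mem_nhds hx0)).hasDerivWithinAt
  · exact (hc.mono hsub).intervalIntegrable

theorem eq_of_hasDerivWithinAt_zero {φ : ℝ → ℝ} {s : Set ℝ} (hs : Convex ℝ s)
    (h : ∀ x ∈ s, HasDerivWithinAt φ 0 s x) {x y : ℝ} (hx : x ∈ s) (hy : y ∈ s) : φ x = φ y := by
  have := hs.norm_image_sub_le_of_norm_hasDerivWithin_le (C := 0) h (by simp) hy hx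
  rw [zero_mul, norm_le_zero_iff, sub_eq_zero] at this
  exact this

theorem hasDerivWithinAt_of_sub_eq_mul {φ Φ : ℝ → ℝ} {s : Set ℝ} {r : ℝ}
    (h : ∀ y ∈ s, φ y - φ r = (y - r) * Φ y) (hΦ : ContinuousWithinAt Φ s r) :
    HasDerivWithinAt φ (Φ r) s r := by
  rw [hasDerivWithinAt_iff_tendsto_slope]
  refine (hΦ.mono_left (nhdsWithin_mono r sdiff_subset)).congr' ?_
  filter_upwards [self_mem_nhdsWithin] with y hy
  rw [slope_def_field, h y hy.1, mul_div_cancel_left₀ _ (sub_ne_zero.2 hy.2)]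

/-! ### Flows of bounded Lipschitz fields on the line -/

section Flow

variable {T : ℝ} {v : ℝ → ℝ → ℝ} {L M : ℝ}

theorem abs_sub_le_of_solutions (hL : 0 ≤ L)
    (hv : ∀ s ∈ Icc 0 T, ∀ x y, |v s x - v s y| ≤ L * |x - y|) {x y : ℝ → ℝ}
    (hx : ∀ s ∈ Icc 0 T, HasDerivWithinAt x (v s (x s)) (Icc 0 T) s)
    (hy : ∀ s ∈ Icc 0 T, HasDerivWithinAt y (v s (y s)) (Icc 0 T) s)
    {s t : ℝ} (hs : s ∈ Icc 0 T) (ht : t ∈ Icc 0 T) :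
    |x s - y s| ≤ Real.exp (L * T) * |x t - y t| := by
  have hder : ∀ c, ∀ s ∈ Icc 0 T, HasDerivWithinAt
      (fun s => (x s - y s) ^ 2 * Real.exp (c * s))
      ((2 * (x s - y s) * (v s (x s) - v s (y s)) + c * (x s - y s) ^ 2) * Real.exp (c * s))
      (Icc 0 T) s := by
    intro c s hs
    have h1 := (HasDerivWithinAt.fun_sub (hx s hs) (hy s hs)).fun_pow 2
    have h2 := ((hasDerivWithinAt_id s (Icc 0 T)).const_mul c).exp
    have := h1.fun_mul h2
    simp only [id] at this
    refine this.congr_deriv ?_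
    push_cast
    ring
  have hbound : ∀ s ∈ Icc 0 T, |(x s - y s) * (v s (x s) - v s (y s))| ≤ L * (x s - y s) ^ 2 := by
    intro s hs
    rw [abs_mul, ← sq_abs (x s - y s)]
    nlinarith [hv s hs (x s) (y s), abs_nonneg (x s - y s)]
  have hmono : MonotoneOn (fun s => (x s - y s) ^ 2 * Real.exp (2 * L * s)) (Icc 0 T) := by
    refine monotoneOn_of_hasDerivWithinAt_nonneg (convex_Icc 0 T)
      (fun s hs => (hder _ s hs).continuousWithinAt)
      (fun s hs => (hder _ s (interior_subset hs)).mono interior_subset) (fun s hs => ?_)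
    refine mul_nonneg ?_ (Real.exp_pos _).le
    nlinarith [neg_abs_le ((x s - y s) * (v s (x s) - v s (y s))), hbound s (interior_subset hs)]
  have hanti : AntitoneOn (fun s => (x s - y s) ^ 2 * Real.exp (-(2 * L) * s)) (Icc 0 T) := by
    refine antitoneOn_of_hasDerivWithinAt_nonpos (convex_Icc 0 T)
      (fun s hs => (hder _ s hs).continuousWithinAt)
      (fun s hs => (hder _ s (interior_subset hs)).mono interior_subset) (fun s hs => ?_)
    refine mul_nonpos_of_nonpos_of_nonneg ?_ (Real.exp_pos _).le
    nlinarith [le_abs_self ((x s - y s) * (v s (x s) - v s (y s))), hbound s (interior_subset hs)]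
  have key : (x s - y s) ^ 2 ≤ (x t - y t) ^ 2 * Real.exp (2 * (L * T)) := by
    have hmul : ∀ c d, (x s - y s) ^ 2 * Real.exp c ≤ (x t - y t) ^ 2 * Real.exp d →
        d - c ≤ 2 * (L * T) → (x s - y s) ^ 2 ≤ (x t - y t) ^ 2 * Real.exp (2 * (L * T)) := by
      intro c d h hcd
      have : (x s - y s) ^ 2 ≤ (x t - y t) ^ 2 * Real.exp (d - c) := by
        rw [Real.exp_sub, ← mul_div_assoc, le_div_iff₀ (Real.exp_pos _)]
        exact h
      exact this.trans (by gcongr)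
    rcases le_total s t with hst | hst
    · refine hmul _ _ (hmono hs ht hst) ?_
      nlinarith [mul_nonneg hL hs.1, mul_le_mul_of_nonneg_left ht.2 hL]
    · refine hmul _ _ (hanti ht hs hst) ?_
      nlinarith [mul_nonneg hL ht.1, mul_le_mul_of_nonneg_left hs.2 hL]
  refine abs_le_of_sq_le_sq ?_ (by positivity)
  rw [mul_pow, sq_abs, ← Real.exp_nat_mul]
  push_cast
  linarith

theorem exists_solution (hL : 0 ≤ L) (hM : 0 ≤ M) (hT : 0 ≤ T)
    (hv : ∀ s ∈ Icc 0 T, ∀ x y, |v s x - v s y| ≤ L * |x - y|)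
    (hvc : ∀ x, ContinuousOn (fun s => v s x) (Icc 0 T))
    (hvM : ∀ s ∈ Icc 0 T, ∀ x, |v s x| ≤ M) {t : ℝ} (ht : t ∈ Icc 0 T) (r : ℝ) :
    ∃ x : ℝ → ℝ, x t = r ∧ ∀ s ∈ Icc 0 T, HasDerivWithinAt x (v s (x s)) (Icc 0 T) s := by
  have hpl : IsPicardLindelof v (⟨t, ht⟩ : Icc 0 T) r ⟨M * T, by positivity⟩ 0 ⟨M, hM⟩ ⟨L, hL⟩ := by
    refine ⟨fun s hs => ?_, fun x _ => hvc x, fun s hs x _ => hvM s hs x, ?_⟩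
    · exact LipschitzOnWith.of_dist_le_mul fun x _ y _ => hv s hs x y
    · simp only [NNReal.coe_zero, sub_zero]
      exact mul_le_mul_of_nonneg_left (max_le (by linarith [ht.1]) ht.2) hM
  obtain ⟨x, hx, hx'⟩ := hpl.exists_eq_forall_mem_Icc_hasDerivWithinAt₀
  exact ⟨x, hx, hx'⟩

theorem exists_continuous_flow (hL : 0 ≤ L) (hM : 0 ≤ M) (hT : 0 ≤ T)
    (hv : ∀ s ∈ Icc 0 T, ∀ x y, |v s x - v s y| ≤ L * |x - y|)
    (hvc : ∀ x, ContinuousOn (fun s => v s x) (Icc 0 T))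
    (hvM : ∀ s ∈ Icc 0 T, ∀ x, |v s x| ≤ M) :
    ∃ X : ℝ → ℝ → ℝ → ℝ, (∀ t ∈ Icc 0 T, ∀ r, X t t r = r) ∧
      (∀ t ∈ Icc 0 T, ∀ r, ∀ s ∈ Icc 0 T,
        HasDerivWithinAt (fun s => X s t r) (v s (X s t r)) (Icc 0 T) s) ∧
      ContinuousOn (fun q : ℝ × ℝ × ℝ => X q.1 q.2.1 q.2.2) (Icc 0 T ×ˢ Icc 0 T ×ˢ univ) := by
  choose x hx hx' using fun (t : Icc 0 T) (r : ℝ) =>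
    exists_solution hL hM hT hv hvc hvM t.2 r
  have hlip : ∀ t r, ∀ s ∈ Icc 0 T, ∀ s' ∈ Icc 0 T, |x t r s - x t r s'| ≤ M * |s - s'| :=
    fun t r s hs s' hs' => (convex_Icc 0 T).norm_image_sub_le_of_norm_hasDerivWithin_le
      (hx' t r) (fun τ hτ => hvM τ hτ _) hs' hs
  refine ⟨fun s t r => x (projIcc 0 T hT t) r s, ?_, ?_, ?_⟩
  · intro t ht r
    simp only [projIcc_of_mem hT ht]
    exact hx ⟨t, ht⟩ r
  · intro t ht r s hs
    exact hx' _ r s hs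
  · refine LipschitzOnWith.continuousOn (K := ⟨M + Real.exp (L * T) * (M + 1), by positivity⟩)
      (LipschitzOnWith.of_dist_le_mul ?_)
    rintro ⟨s, t, r⟩ ⟨hs, ht, -⟩ ⟨s', t', r'⟩ ⟨hs', ht', -⟩
    simp only at hs ht hs' ht'
    simp only [projIcc_of_mem hT ht, projIcc_of_mem hT ht', Prod.dist_eq, Real.dist_eq]
    set d := max |s - s'| (max |t - t'| |r - r'|) with hd
    have d1 : |s - s'| ≤ d := le_max_left _ _
    have d2 : |t - t'| ≤ d := (le_max_left _ _).trans (le_max_right _ _)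
    have d3 : |r - r'| ≤ d := (le_max_right _ _).trans (le_max_right _ _)
    have e1 := hlip ⟨t, ht⟩ r s hs s' hs'
    have e2 := abs_sub_le_of_solutions hL hv (hx' ⟨t, ht⟩ r) (hx' ⟨t', ht'⟩ r') hs' ht
    have e3 := hlip ⟨t', ht'⟩ r' t' ht' t ht
    have e4 : x ⟨t, ht⟩ r t = r := hx _ _
    have e5 : x ⟨t', ht'⟩ r' t' = r' := hx _ _
    have e6 : |x ⟨t, ht⟩ r t - x ⟨t', ht'⟩ r' t| ≤ (M + 1) * d := by
      rw [e4]
      rw [e5, abs_sub_comm t' t] at e3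
      have : |r - x ⟨t', ht'⟩ r' t| ≤ |r - r'| + |r' - x ⟨t', ht'⟩ r' t| := abs_sub_le _ _ _
      nlinarith [mul_le_mul_of_nonneg_left d2 hM]
    calc |x ⟨t, ht⟩ r s - x ⟨t', ht'⟩ r' s'|
        ≤ |x ⟨t, ht⟩ r s - x ⟨t, ht⟩ r s'| + |x ⟨t, ht⟩ r s' - x ⟨t', ht'⟩ r' s'| :=
          abs_sub_le _ _ _
      _ ≤ M * d + Real.exp (L * T) * ((M + 1) * d) := by
          refine add_le_add (e1.trans (by gcongr)) (e2.trans ?_)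
          gcongr
      _ = (M + Real.exp (L * T) * (M + 1)) * d := by ring

end Flow

/-! ### Characteristics -/

section Characteristics

variable {T K : ℝ} {b bt br : ℝ → ℝ → ℝ}

theorem HasPartials.hasDerivWithinAt_along {g gt gr : ℝ → ℝ → ℝ}
    (h : HasPartials (Icc 0 T) (Ici 0) g gt gr) {S : Set ℝ} (hS : S ⊆ Icc 0 T) {y : ℝ → ℝ}
    (hy0 : ∀ s ∈ S, 0 ≤ y s) {s y' : ℝ} (hs : s ∈ S) (hy : HasDerivWithinAt y y' S s) :
    HasDerivWithinAt (fun s => g s (y s)) (gt s (y s) + y' * gr s (y s)) S s := by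
  have h1 := h.hasFDerivWithinAt (convex_Icc 0 T) (convex_Ici 0) (hS hs) (hy0 s hs)
  have hm : MapsTo (fun s => (s, y s)) S (Icc 0 T ×ˢ Ici 0) := fun s hs => ⟨hS hs, hy0 s hs⟩
  have := h1.comp_hasDerivWithinAt s ((hasDerivWithinAt_id s S).prodMk hy) hm
  refine this.congr_deriv ?_
  simp [mul_comm]

/-- A bound on `∂_t b - b ∂_r b` keeps the characteristics of `∂_t - b ∂_r` bounded. -/
theorem abs_sub_le_of_characteristic (hb : HasPartials (Icc 0 T) (Ici 0) b bt br)
    (hK : ∀ t ∈ Icc 0 T, ∀ r ∈ Ici (0 : ℝ), |bt t r - b t r * br t r| ≤ K)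
    {s t : ℝ} (hs : 0 ≤ s) (hst : s ≤ t) (ht : t ≤ T) {y : ℝ → ℝ} (hy0 : ∀ τ ∈ Icc s t, 0 ≤ y τ)
    (hy : ∀ τ ∈ Icc s t, HasDerivWithinAt y (-b τ (y τ)) (Icc s t) τ) :
    |y s - y t| ≤ (|b t (y t)| + K * T) * T := by
  have hS : Icc s t ⊆ Icc 0 T := Icc_subset_Icc hs ht
  have hT : 0 ≤ T := hs.trans (hst.trans ht)
  have htt : t ∈ Icc s t := ⟨hst, le_rfl⟩
  have hK0 : 0 ≤ K := (abs_nonneg _).trans (hK t (hS htt) (y t) (hy0 t htt))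
  have hlen : ∀ τ ∈ Icc s t, |τ - t| ≤ T := by
    intro τ hτ
    rw [abs_sub_comm, abs_of_nonneg (by linarith [hτ.2])]
    linarith [hτ.1]
  have hw : ∀ τ ∈ Icc s t, |b τ (y τ)| ≤ |b t (y t)| + K * T := by
    intro τ hτ
    have := (convex_Icc s t).norm_image_sub_le_of_norm_hasDerivWithin_le
      (f := fun τ => b τ (y τ)) (C := K)
      (fun τ hτ => hb.hasDerivWithinAt_along hS hy0 hτ (hy τ hτ))
      (fun τ hτ => by
        rw [neg_mul, ← sub_eq_add_neg]
        exact hK τ (hS hτ) _ (hy0 τ hτ)) htt hτ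
    rw [Real.norm_eq_abs, Real.norm_eq_abs] at this
    have h2 := abs_sub_abs_le_abs_sub (b τ (y τ)) (b t (y t))
    nlinarith [mul_le_mul_of_nonneg_left (hlen τ hτ) hK0]
  have := (convex_Icc s t).norm_image_sub_le_of_norm_hasDerivWithin_le (C := |b t (y t)| + K * T)
    hy (fun τ hτ => by rw [norm_neg]; exact hw τ hτ) htt ⟨le_rfl, hst⟩
  refine this.trans ?_
  exact mul_le_mul_of_nonneg_left (hlen s ⟨le_rfl, hst⟩) (by positivity)

theorem slice_left {φ : ℝ → ℝ → ℝ} {J R : Set ℝ}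
    (hφ : ContinuousOn (fun q : ℝ × ℝ => φ q.1 q.2) (J ×ˢ R)) {y : ℝ} (hy : y ∈ R) :
    ContinuousOn (fun s => φ s y) J :=
  hφ.comp (f := fun s => (s, y)) (by fun_prop) (fun _ hs => ⟨hs, hy⟩)

theorem slice_right {φ : ℝ → ℝ → ℝ} {J R : Set ℝ}
    (hφ : ContinuousOn (fun q : ℝ × ℝ => φ q.1 q.2) (J ×ˢ R)) {s : ℝ} (hs : s ∈ J) :
    ContinuousOn (φ s) R :=
  hφ.comp (f := fun y => (s, y)) (by fun_prop) (fun _ hy => ⟨hs, hy⟩)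

theorem exists_abs_le {φ : ℝ → ℝ → ℝ} {r : ℝ}
    (hφ : ContinuousOn (fun q : ℝ × ℝ => φ q.1 q.2) (Icc 0 T ×ˢ Ici 0)) :
    ∃ C, 0 ≤ C ∧ ∀ s ∈ Icc 0 T, ∀ y ∈ Icc 0 r, |φ s y| ≤ C := by
  obtain ⟨C, hC⟩ := (isCompact_Icc.prod isCompact_Icc).exists_bound_of_continuousOn
    (hφ.mono (prod_mono (subset_refl (Icc 0 T)) (fun _ hy => hy.1 : Icc 0 r ⊆ Ici 0)))
  exact ⟨max C 0, le_max_right _ _, fun s hs y hy => (hC (s, y) ⟨hs, hy⟩).trans (le_max_left _ _)⟩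

/-- The backward characteristics of `∂_t - b ∂_r` starting in a bounded set. -/
theorem exists_characteristics (hT : 0 ≤ T) (hb : HasPartials (Icc 0 T) (Ici 0) b bt br)
    (hb0 : ∀ t ∈ Icc 0 T, b t 0 = 0)
    (hK : ∀ t ∈ Icc 0 T, ∀ r ∈ Ici (0 : ℝ), |bt t r - b t r * br t r| ≤ K) (r₁ : ℝ) :
    ∃ X : ℝ → ℝ → ℝ → ℝ, (∀ s t r, 0 ≤ X s t r) ∧
      (∀ t ∈ Icc 0 T, ∀ r ∈ Icc 0 r₁, X t t r = r) ∧
      (∀ t ∈ Icc 0 T, ∀ r ∈ Icc 0 r₁, ∀ s ∈ Icc 0 t,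
        HasDerivWithinAt (fun s => X s t r) (-b s (X s t r)) (Icc 0 t) s) ∧
      ContinuousOn (fun q : ℝ × ℝ × ℝ => X q.1 q.2.1 q.2.2)
        (Icc 0 T ×ˢ Icc 0 T ×ˢ Icc 0 r₁) := by
  have hbc := hb.continuousOn (convex_Icc 0 T) (convex_Ici 0)
  obtain ⟨B, hB0, hB⟩ := exists_abs_le (r := r₁) hbc
  set N : ℝ := max (r₁ + (B + K * T) * T) 0 + 1 with hN
  have hN0 : 0 ≤ N := by positivity
  obtain ⟨M, hM0, hM⟩ := exists_abs_le (r := N) hbc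
  obtain ⟨L, hL0, hL⟩ := exists_abs_le (r := N) hb.cont_right
  set c : ℝ → ℝ := fun x => max 0 (min N x) with hc
  have hcc : Continuous c := by fun_prop
  have hcmem : ∀ x, c x ∈ Icc 0 N := fun x => ⟨le_max_left _ _, max_le hN0 (min_le_left _ _)⟩
  have hc_of : ∀ x ∈ Icc 0 N, c x = x := fun x hx => by
    simp only [hc, min_eq_right hx.2, max_eq_right hx.1]
  have hclip : ∀ x y, |c x - c y| ≤ |x - y| := fun x y => by
    have h := ((LipschitzWith.id.const_min N).const_max 0).dist_le_mul x y
    simpa [Real.dist_eq] using h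
  have hv : ∀ s ∈ Icc 0 T, ∀ x y, |-b s (c x) - -b s (c y)| ≤ L * |x - y| := by
    intro s hs x y
    have h1 := (convex_Icc 0 N).norm_image_sub_le_of_norm_hasDerivWithin_le (f := b s) (C := L)
      (fun z hz => (hb.right s hs z hz.1).mono Icc_subset_Ici_self)
      (fun z hz => hL s hs z hz) (hcmem x) (hcmem y)
    rw [show -b s (c x) - -b s (c y) = b s (c y) - b s (c x) by ring]
    refine h1.trans (mul_le_mul_of_nonneg_left ?_ hL0)
    rw [Real.norm_eq_abs, abs_sub_comm]
    exact hclip x y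
  have hvc : ∀ x, ContinuousOn (fun s => -b s (c x)) (Icc 0 T) :=
    fun x => (slice_left hbc (hcmem x).1).neg
  have hvM : ∀ s ∈ Icc 0 T, ∀ x, |-b s (c x)| ≤ M := fun s hs x => by
    rw [abs_neg]
    exact hM s hs _ (hcmem x)
  obtain ⟨Y, hY, hYd, hYc⟩ := exists_continuous_flow hL0 hM0 hT hv hvc hvM
  have hYcs : ∀ t ∈ Icc 0 T, ∀ r, ContinuousOn (fun s => Y s t r) (Icc 0 T) :=
    fun t ht r s hs => (hYd t ht r s hs).continuousWithinAt
  have hzero : ∀ s ∈ Icc 0 T, HasDerivWithinAt (fun _ : ℝ => (0 : ℝ))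
      (-b s (c ((fun _ : ℝ => (0 : ℝ)) s))) (Icc 0 T) s := by
    intro s hs
    simp only [hc_of 0 ⟨le_rfl, hN0⟩, hb0 s hs, neg_zero]
    exact hasDerivWithinAt_const _ _ _
  have hnonneg : ∀ t ∈ Icc 0 T, ∀ r ∈ Icc 0 r₁, ∀ s ∈ Icc 0 t, 0 ≤ Y s t r := by
    intro t ht r hr s hs
    by_contra! hneg
    have hsT : s ∈ Icc 0 T := ⟨hs.1, hs.2.trans ht.2⟩
    have hsub : Icc s t ⊆ Icc 0 T := Icc_subset_Icc hs.1 ht.2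
    obtain ⟨τ, hτ, hτ0⟩ := intermediate_value_Icc hs.2 ((hYcs t ht r).mono hsub)
      (show (0 : ℝ) ∈ Icc (Y s t r) (Y t t r) from ⟨hneg.le, by rw [hY t ht]; exact hr.1⟩)
    have := abs_sub_le_of_solutions hL0 hv (hYd t ht r) hzero hsT (hsub hτ)
    simp only [hτ0, sub_zero, abs_zero, mul_zero] at this
    exact hneg.ne (abs_nonpos_iff.1 this)
  have hupper : ∀ t ∈ Icc 0 T, ∀ r ∈ Icc 0 r₁, ∀ s ∈ Icc 0 t, Y s t r ≤ N := by
    intro t ht r hr s hs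
    by_contra! hbig
    have hsub : Icc s t ⊆ Icc 0 T := Icc_subset_Icc hs.1 ht.2
    have hcont := (hYcs t ht r).mono hsub
    have hKT : (B + K * T) * T ≥ 0 := by
      have : 0 ≤ K := (abs_nonneg _).trans (hK t ht 0 (mem_Ici.2 le_rfl))
      positivity
    have hrN : r + (B + K * T) * T < N := by
      have := le_max_left (r₁ + (B + K * T) * T) 0
      linarith [hr.2]
    have hcomp : IsCompact (Icc s t ∩ (fun s => Y s t r) ⁻¹' Ici N) :=
      isCompact_Icc.of_isClosed_subset
        (hcont.preimage_isClosed_of_isClosed isClosed_Icc isClosed_Ici) inter_subset_left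
    obtain ⟨s₁, ⟨hs₁, hs₁N⟩, hmax⟩ :=
      hcomp.exists_isGreatest ⟨s, ⟨le_rfl, hs.2⟩, hbig.le⟩
    have hsub₁ : Icc s₁ t ⊆ Icc s t := Icc_subset_Icc_left hs₁.1
    have hle : ∀ τ ∈ Icc s₁ t, Y τ t r ≤ N := by
      intro τ hτ
      by_contra! hτN
      obtain ⟨τ', hτ', hτ'N⟩ := intermediate_value_Icc' hτ.2
        (hcont.mono (Icc_subset_Icc_left (hsub₁ hτ).1))
        (show N ∈ Icc (Y t t r) (Y τ t r) from ⟨by rw [hY t ht]; linarith, hτN.le⟩)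
      have h1 : τ' ≤ s₁ := hmax ⟨⟨(hsub₁ hτ).1.trans hτ'.1, hτ'.2⟩, hτ'N.ge⟩
      have h2 : τ' = τ := le_antisymm (h1.trans hτ.1) hτ'.1
      rw [h2] at hτ'N
      exact hτN.ne hτ'N.symm
    have hin : ∀ τ ∈ Icc s₁ t, Y τ t r ∈ Icc 0 N := fun τ hτ =>
      ⟨hnonneg t ht r hr τ ⟨hs.1.trans (hsub₁ hτ).1, hτ.2⟩, hle τ hτ⟩
    have hest := abs_sub_le_of_characteristic hb hK (hs.1.trans hs₁.1) hs₁.2 ht.2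
      (y := fun τ => Y τ t r) (fun τ hτ => (hin τ hτ).1) (fun τ hτ => by
        have := (hYd t ht r τ (hsub (hsub₁ hτ))).mono (hsub₁.trans hsub)
        rwa [hc_of _ (hin τ hτ)] at this)
    simp only [hY t ht] at hest
    have h3 := le_abs_self (Y s₁ t r - r)
    have h4 : (|b t r| + K * T) * T ≤ (B + K * T) * T := by
      have := hB t ht r hr
      gcongr
    have h5 : N ≤ Y s₁ t r := hs₁N
    linarith
  have hin : ∀ t ∈ Icc 0 T, ∀ r ∈ Icc 0 r₁, ∀ s ∈ Icc 0 t, c (Y s t r) = Y s t r :=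
    fun t ht r hr s hs => hc_of _ ⟨hnonneg t ht r hr s hs, hupper t ht r hr s hs⟩
  refine ⟨fun s t r => c (Y s t r), fun s t r => (hcmem _).1, ?_, ?_, ?_⟩
  · intro t ht r hr
    exact (hin t ht r hr t ⟨ht.1, le_rfl⟩).trans (hY t ht r)
  · intro t ht r hr s hs
    have hsub : Icc 0 t ⊆ Icc 0 T := Icc_subset_Icc_right ht.2
    exact ((hYd t ht r s (hsub hs)).mono hsub).congr (fun τ hτ => hin t ht r hr τ hτ)
      (hin t ht r hr s hs)
  · exact hcc.comp_continuousOn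
      (hYc.mono (prod_mono subset_rfl (prod_mono subset_rfl (subset_univ _))))

end Characteristics

/-! ### Differentiability of the characteristic flow -/

/-- `X s t r` is the position at time `s ≤ t` of the characteristic of `∂_t - b ∂_r` that passes
through `r` at time `t`; `E` and `E'` are its first and second derivative with respect to `r`. -/
structure IsCharacteristicFlow (T r₁ : ℝ) (b br : ℝ → ℝ → ℝ) (X E E' : ℝ → ℝ → ℝ → ℝ) : Prop where
  nonneg : ∀ s t r, 0 ≤ X s t r
  self : ∀ t ∈ Icc 0 T, ∀ r ∈ Icc 0 r₁, X t t r = r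
  self_deriv : ∀ t ∈ Icc 0 T, ∀ r ∈ Icc 0 r₁, E t t r = 1
  hasDeriv_time : ∀ t ∈ Icc 0 T, ∀ r ∈ Icc 0 r₁, ∀ s ∈ Icc 0 t,
    HasDerivWithinAt (fun s => X s t r) (-b s (X s t r)) (Icc 0 t) s
  hasDeriv_time_deriv : ∀ t ∈ Icc 0 T, ∀ r ∈ Icc 0 r₁, ∀ s ∈ Icc 0 t,
    HasDerivWithinAt (fun s => E s t r) (-(br s (X s t r) * E s t r)) (Icc 0 t) s
  hasDeriv : ∀ t ∈ Icc 0 T, ∀ r ∈ Icc 0 r₁, ∀ s ∈ Icc 0 t,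
    HasDerivWithinAt (fun r => X s t r) (E s t r) (Icc 0 r₁) r
  hasDeriv_deriv : ∀ t ∈ Icc 0 T, ∀ r ∈ Icc 0 r₁, ∀ s ∈ Icc 0 t,
    HasDerivWithinAt (fun r => E s t r) (E' s t r) (Icc 0 r₁) r
  cont : ContinuousOn (fun q : ℝ × ℝ × ℝ => X q.1 q.2.1 q.2.2) (Icc 0 T ×ˢ Icc 0 T ×ˢ Icc 0 r₁)
  cont_deriv : ContinuousOn (fun q : ℝ × ℝ × ℝ => E q.1 q.2.1 q.2.2)
    (Icc 0 T ×ˢ Icc 0 T ×ˢ Icc 0 r₁)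
  cont_deriv2 : ContinuousOn (fun q : ℝ × ℝ × ℝ => E' q.1 q.2.1 q.2.2)
    (Icc 0 T ×ˢ Icc 0 T ×ˢ Icc 0 r₁)

section

variable {T K r₁ : ℝ} {b bt br brt brr : ℝ → ℝ → ℝ}

theorem continuousOn_along {φ : ℝ → ℝ → ℝ} {X : ℝ → ℝ → ℝ → ℝ}
    (hφ : ContinuousOn (fun q : ℝ × ℝ => φ q.1 q.2) (Icc 0 T ×ˢ Ici 0))
    (hX0 : ∀ s t r, 0 ≤ X s t r)
    (hX : ContinuousOn (fun q : ℝ × ℝ × ℝ => X q.1 q.2.1 q.2.2)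
      (Icc 0 T ×ˢ Icc 0 T ×ˢ Icc 0 r₁)) :
    ContinuousOn (fun q : ℝ × ℝ × ℝ => φ q.1 (X q.1 q.2.1 q.2.2))
      (Icc 0 T ×ˢ Icc 0 T ×ˢ Icc 0 r₁) :=
  hφ.comp (f := fun q : ℝ × ℝ × ℝ => (q.1, X q.1 q.2.1 q.2.2))
    (continuousOn_fst.prodMk hX) (fun _ hq => ⟨hq.1, hX0 _ _ _⟩)

theorem continuousOn_integral_along {Ψ : ℝ → ℝ → ℝ → ℝ}
    (hΨ : ContinuousOn (fun q : ℝ × ℝ × ℝ => Ψ q.1 q.2.1 q.2.2)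
      (Icc 0 T ×ˢ Icc 0 T ×ˢ Icc 0 r₁)) :
    ContinuousOn (fun q : ℝ × ℝ × ℝ => ∫ τ in q.1..q.2.1, Ψ τ q.2.1 q.2.2)
      (Icc 0 T ×ˢ Icc 0 T ×ˢ Icc 0 r₁) :=
  (continuousOn_intervalIntegral_param (Ψ := fun τ (q : ℝ × ℝ) => Ψ τ q.1 q.2)
    (convex_Icc 0 T) hΨ).comp (f := fun q : ℝ × ℝ × ℝ => (q.1, q.2.1, q.2)) (by fun_prop)
    (fun _ hq => ⟨hq.1, hq.2.1, hq.2⟩)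

theorem continuousOn_time_slice {Ψ : ℝ → ℝ → ℝ → ℝ}
    (hΨ : ContinuousOn (fun q : ℝ × ℝ × ℝ => Ψ q.1 q.2.1 q.2.2)
      (Icc 0 T ×ˢ Icc 0 T ×ˢ Icc 0 r₁)) {t r : ℝ} (ht : t ∈ Icc 0 T) (hr : r ∈ Icc 0 r₁) :
    ContinuousOn (fun s => Ψ s t r) (Icc 0 T) :=
  hΨ.comp (f := fun s : ℝ => (s, t, r)) (by fun_prop) (fun _ hs => ⟨hs, ht, hr⟩)

theorem continuousOn_space_time_slice {Ψ : ℝ → ℝ → ℝ → ℝ}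
    (hΨ : ContinuousOn (fun q : ℝ × ℝ × ℝ => Ψ q.1 q.2.1 q.2.2)
      (Icc 0 T ×ˢ Icc 0 T ×ˢ Icc 0 r₁)) {s t t' : ℝ} (ht : t ∈ Icc 0 T) (hs : 0 ≤ s)
    (ht' : t' ≤ T) :
    ContinuousOn (fun q : ℝ × ℝ => Ψ q.2 t q.1) (Icc 0 r₁ ×ˢ Icc s t') :=
  hΨ.comp (f := fun q : ℝ × ℝ => (q.2, t, q.1)) (by fun_prop)
    (fun _ hq => ⟨⟨hs.trans hq.2.1, hq.2.2.trans ht'⟩, ht, hq.1⟩)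

theorem hasDerivWithinAt_characteristics {X : ℝ → ℝ → ℝ → ℝ}
    (hb : HasPartials (Icc 0 T) (Ici 0) b bt br) (hX0 : ∀ s t r, 0 ≤ X s t r)
    (hXs : ∀ t ∈ Icc 0 T, ∀ r ∈ Icc 0 r₁, X t t r = r)
    (hXd : ∀ t ∈ Icc 0 T, ∀ r ∈ Icc 0 r₁, ∀ s ∈ Icc 0 t,
        HasDerivWithinAt (fun s => X s t r) (-b s (X s t r)) (Icc 0 t) s)
    (hX : ContinuousOn (fun q : ℝ × ℝ × ℝ => X q.1 q.2.1 q.2.2) (Icc 0 T ×ˢ Icc 0 T ×ˢ Icc 0 r₁))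
    {s t r : ℝ} (ht : t ∈ Icc 0 T) (hr : r ∈ Icc 0 r₁) (hs : s ∈ Icc 0 t) :
    HasDerivWithinAt (fun r => X s t r) (Real.exp (∫ τ in s..t, br τ (X τ t r))) (Icc 0 r₁) r := by
  set k : ℝ → ℝ → ℝ := fun τ y =>
    ∫ σ in Icc (0 : ℝ) 1, br τ (X τ t r + (X τ t y - X τ t r) * σ) with hk
  have hsT : s ∈ Icc 0 T := ⟨hs.1, hs.2.trans ht.2⟩
  have hkc : ContinuousOn (fun q : ℝ × ℝ => k q.1 q.2) (Icc 0 T ×ˢ Icc 0 r₁) := by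
    refine continuousOn_setIntegral (F := fun (q : ℝ × ℝ) σ =>
      br q.1 (X q.1 t r + (X q.1 t q.2 - X q.1 t r) * σ)) isCompact_Icc ?_
    have h1 : ContinuousOn (fun z : (ℝ × ℝ) × ℝ => X z.1.1 t r)
        ((Icc 0 T ×ˢ Icc 0 r₁) ×ˢ Icc 0 1) :=
      hX.comp (f := fun z : (ℝ × ℝ) × ℝ => (z.1.1, t, r)) (by fun_prop)
        (fun _ hz => ⟨hz.1.1, ht, hr⟩)
    have h2 : ContinuousOn (fun z : (ℝ × ℝ) × ℝ => X z.1.1 t z.1.2)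
        ((Icc 0 T ×ˢ Icc 0 r₁) ×ˢ Icc 0 1) :=
      hX.comp (f := fun z : (ℝ × ℝ) × ℝ => (z.1.1, t, z.1.2)) (by fun_prop)
        (fun _ hz => ⟨hz.1.1, ht, hz.1.2⟩)
    refine hb.cont_right.comp (f := fun z : (ℝ × ℝ) × ℝ =>
      (z.1.1, X z.1.1 t r + (X z.1.1 t z.1.2 - X z.1.1 t r) * z.2))
      ((continuousOn_fst.comp continuousOn_fst fun _ hz => hz.1).prodMk
        (h1.add ((h2.sub h1).mul continuousOn_snd))) ?_
    intro z hz
    exact ⟨hz.1.1, add_mul_sub_mem (convex_Ici 0) (hX0 _ _ _) (hX0 _ _ _) hz.2⟩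
  have hkr : ∀ τ, k τ r = br τ (X τ t r) := by
    intro τ
    simp [hk]
  have hint : ContinuousOn (fun y => Real.exp (∫ τ in s..t, k τ y)) (Icc 0 r₁) :=
    Real.continuous_exp.comp_continuousOn
      ((continuousOn_intervalIntegral_param (Ψ := k) (convex_Icc 0 T) hkc).comp
        (f := fun y => (s, t, y)) (by fun_prop) (fun y hy => ⟨hsT, ht, hy⟩))
  have hformula : ∀ y ∈ Icc 0 r₁,
      X s t y - X s t r = (y - r) * Real.exp (∫ τ in s..t, k τ y) := by
    intro y hy
    have hsub : Icc 0 t ⊆ Icc 0 T := Icc_subset_Icc_right ht.2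
    have htt : t ∈ Icc 0 t := ⟨ht.1, le_rfl⟩
    have hky : ContinuousOn (fun τ => k τ y) (Icc 0 t) := (slice_left hkc hy).mono hsub
    have hconst := eq_of_hasDerivWithinAt_zero (convex_Icc 0 t)
      (φ := fun τ => (X τ t y - X τ t r) * Real.exp (-∫ τ in τ..t, k τ y)) (fun τ hτ => by
        have h1 := HasDerivWithinAt.fun_sub (hXd t ht y hy τ hτ) (hXd t ht r hr τ hτ)
        have h2 := (HasDerivWithinAt.fun_neg (hasDerivWithinAt_integral_left hky htt hτ)).exp
        refine (h1.fun_mul h2).congr_deriv ?_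
        have h3 := sub_eq_mul_setIntegral_deriv (hb.right τ (hsub hτ))
          (slice_right hb.cont_right (hsub hτ)) (hX0 τ t r) (hX0 τ t y)
        change _ = (X τ t y - X τ t r) * k τ y at h3
        linear_combination (-Real.exp (-∫ τ in τ..t, k τ y)) * h3) hs htt
    simp only [intervalIntegral.integral_same, neg_zero, Real.exp_zero, mul_one,
      hXs t ht y hy, hXs t ht r hr] at hconst
    rw [← hconst, mul_assoc, ← Real.exp_add]
    simp
  have := hasDerivWithinAt_of_sub_eq_mul hformula (hint r hr)
  simpa only [hkr] using this

theorem exists_isCharacteristicFlow (hT : 0 ≤ T) (hb : HasPartials (Icc 0 T) (Ici 0) b bt br)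
    (hbr : HasPartials (Icc 0 T) (Ici 0) br brt brr) (hb0 : ∀ t ∈ Icc 0 T, b t 0 = 0)
    (hK : ∀ t ∈ Icc 0 T, ∀ r ∈ Ici (0 : ℝ), |bt t r - b t r * br t r| ≤ K) (r₁ : ℝ) :
    ∃ X E E', IsCharacteristicFlow T r₁ b br X E E' := by
  obtain ⟨X, hX0, hXs, hXd, hX⟩ := exists_characteristics hT hb hb0 hK r₁
  set E : ℝ → ℝ → ℝ → ℝ := fun s t r => Real.exp (∫ τ in s..t, br τ (X τ t r)) with hE
  have hbrX := continuousOn_along hb.cont_right hX0 hX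
  have hbrrX := continuousOn_along hbr.cont_right hX0 hX
  have hEc : ContinuousOn (fun q : ℝ × ℝ × ℝ => E q.1 q.2.1 q.2.2)
      (Icc 0 T ×ˢ Icc 0 T ×ˢ Icc 0 r₁) :=
    Real.continuous_exp.comp_continuousOn
      (continuousOn_integral_along (Ψ := fun s t r => br s (X s t r)) hbrX)
  have hEr : ∀ t ∈ Icc 0 T, ∀ r ∈ Icc 0 r₁, ∀ s ∈ Icc 0 t,
      HasDerivWithinAt (fun r => X s t r) (E s t r) (Icc 0 r₁) r := fun t ht r hr s hs =>
    hasDerivWithinAt_characteristics hb hX0 hXs hXd hX ht hr hs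
  have hmul : ContinuousOn
      (fun q : ℝ × ℝ × ℝ => brr q.1 (X q.1 q.2.1 q.2.2) * E q.1 q.2.1 q.2.2)
      (Icc 0 T ×ˢ Icc 0 T ×ˢ Icc 0 r₁) := hbrrX.mul hEc
  refine ⟨X, E, fun s t r => E s t r * ∫ τ in s..t, brr τ (X τ t r) * E τ t r, hX0, hXs, ?_, hXd,
    ?_, hEr, ?_, hX, hEc, ?_⟩
  · intro t ht r hr
    simp [hE]
  · intro t ht r hr s hs
    have hsub : Icc 0 t ⊆ Icc 0 T := Icc_subset_Icc_right ht.2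
    have h1 := (continuousOn_time_slice (Ψ := fun s t r => br s (X s t r)) hbrX ht hr).mono hsub
    have h2 := (hasDerivWithinAt_integral_left h1 (right_mem_Icc.2 ht.1) hs).exp
    refine h2.congr_deriv ?_
    ring
  · intro t ht r hr s hs
    have h1 : HasDerivWithinAt (fun r => ∫ τ in Icc s t, br τ (X τ t r))
        (∫ τ in Icc s t, brr τ (X τ t r) * E τ t r) (Icc 0 r₁) r := by
      refine hasDerivWithinAt_setIntegral (F := fun r τ => br τ (X τ t r))
        (F' := fun r τ => brr τ (X τ t r) * E τ t r) isCompact_Icc (convex_Icc 0 r₁)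
        (continuousOn_space_time_slice (Ψ := fun s t r => br s (X s t r)) hbrX ht hs.1 ht.2)
        (continuousOn_space_time_slice (Ψ := fun s t r => brr s (X s t r) * E s t r)
          hmul ht hs.1 ht.2) ?_ hr
      intro y hy τ hτ
      have hτ' : τ ∈ Icc 0 t := ⟨hs.1.trans hτ.1, hτ.2⟩
      exact (hbr.right τ ⟨hτ'.1, hτ.2.trans ht.2⟩ _ (hX0 τ t y)).comp y (hEr t ht y hy τ hτ')
        (fun z _ => hX0 τ t z)
    have h2 := h1.exp
    simp only [integral_Icc_eq_integral_Ioc, ← intervalIntegral.integral_of_le hs.2] at h2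
    exact h2
  · exact hEc.mul (continuousOn_integral_along (Ψ := fun s t r => brr s (X s t r) * E s t r) hmul)

/-! ### Regularity for the transport equation -/

variable {u ut ur g gt gr k kt kr h ht hr : ℝ → ℝ → ℝ} {Q' : ℝ → ℝ}

theorem IsCharacteristicFlow.hasDerivWithinAt_comp {X E E' : ℝ → ℝ → ℝ → ℝ}
    (hF : IsCharacteristicFlow T r₁ b br X E E') {φ : ℝ → ℝ} {φ' s t r : ℝ} (ht : t ∈ Icc 0 T)
    (hr : r ∈ Icc 0 r₁) (hs : s ∈ Icc 0 t) (hφ : HasDerivWithinAt φ φ' (Ici 0) (X s t r)) :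
    HasDerivWithinAt (fun r => φ (X s t r)) (φ' * E s t r) (Icc 0 r₁) r :=
  hφ.comp r (hF.hasDeriv t ht r hr s hs) (fun y _ => hF.nonneg s t y)

/-- If `∂_t u - b ∂_r u = g` and `∂_r g` is the sum of the derivative of a `C^1` function along the
characteristics and of a function which is `C^1` in `r`, then `∂_r u` is as regular in `r` as its
initial value permits. -/
theorem IsCharacteristicFlow.exists_second_deriv {X E E' : ℝ → ℝ → ℝ → ℝ}
    (hF : IsCharacteristicFlow T r₁ b br X E E') (hT : 0 ≤ T) (hr₁ : 0 < r₁)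
    (hb : HasPartials (Icc 0 T) (Ici 0) b bt br) (hbr : HasPartials (Icc 0 T) (Ici 0) br brt brr)
    (hu : HasPartials (Icc 0 T) (Ici 0) u ut ur) (hg : HasPartials (Icc 0 T) (Ici 0) g gt gr)
    (hk : HasPartials (Icc 0 T) (Ici 0) k kt kr) (hh : HasPartials (Icc 0 T) (Ici 0) h ht hr)
    (hug : ∀ t ∈ Icc 0 T, ∀ r ∈ Ici (0 : ℝ), ut t r - b t r * ur t r = g t r)
    (hgr : ∀ t ∈ Icc 0 T, ∀ r ∈ Ici (0 : ℝ),
      gr t r = -(kt t r - b t r * kr t r) + h t r)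
    (hQ : ∀ r ∈ Ici (0 : ℝ), HasDerivWithinAt (fun y => ur 0 y + k 0 y) (Q' r) (Ici 0) r)
    (hQc : ContinuousOn Q' (Ici 0)) :
    ∃ urr : ℝ → ℝ → ℝ, (∀ t ∈ Icc 0 T, ∀ r ∈ Icc 0 r₁,
      HasDerivWithinAt (ur t) (urr t r) (Icc 0 r₁) r) ∧
      ContinuousOn (fun q : ℝ × ℝ => urr q.1 q.2) (Icc 0 T ×ˢ Icc 0 r₁) := by
  have cb := hb.continuousOn (convex_Icc 0 T) (convex_Ici 0)
  have cg := hg.continuousOn (convex_Icc 0 T) (convex_Ici 0)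
  have ck := hk.continuousOn (convex_Icc 0 T) (convex_Ici 0)
  have ch := hh.continuousOn (convex_Icc 0 T) (convex_Ici 0)
  have hsub : ∀ t ∈ Icc 0 T, Icc 0 t ⊆ Icc 0 T := fun t ht => Icc_subset_Icc_right ht.2
  have h0 : ∀ t ∈ Icc 0 T, (0 : ℝ) ∈ Icc 0 t := fun t ht => ⟨le_rfl, ht.1⟩
  have h0T : (0 : ℝ) ∈ Icc 0 T := ⟨le_rfl, hT⟩
  have cont := fun {φ : ℝ → ℝ → ℝ}
    (hφ : ContinuousOn (fun q : ℝ × ℝ => φ q.1 q.2) (Icc 0 T ×ˢ Ici 0)) =>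
    continuousOn_along hφ hF.nonneg hF.cont
  set H : ℝ → ℝ → ℝ := fun t r => h t r - k t r * br t r with hH
  set H' : ℝ → ℝ → ℝ := fun t r => hr t r - (kr t r * br t r + k t r * brr t r) with hH'
  have cH : ContinuousOn (fun q : ℝ × ℝ => H q.1 q.2) (Icc 0 T ×ˢ Ici 0) :=
    ch.sub (ck.mul hb.cont_right)
  have cH' : ContinuousOn (fun q : ℝ × ℝ => H' q.1 q.2) (Icc 0 T ×ˢ Ici 0) :=
    hh.cont_right.sub ((hk.cont_right.mul hb.cont_right).add (ck.mul hbr.cont_right))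
  have dH : ∀ t ∈ Icc 0 T, ∀ r ∈ Ici (0 : ℝ), HasDerivWithinAt (H t) (H' t r) (Ici 0) r :=
    fun t ht r hr => (hh.right t ht r hr).sub ((hk.right t ht r hr).mul (hbr.right t ht r hr))
  have repr : ∀ t ∈ Icc 0 T, ∀ r ∈ Icc 0 r₁,
      u t r = u 0 (X 0 t r) + ∫ s in Icc 0 t, g s (X s t r) := by
    intro t ht r hr
    rw [setIntegral_Icc_eq_sub (φ := fun s => u s (X s t r)) ht.1, hF.self t ht r hr]
    · ring
    · intro s hs
      refine (hu.hasDerivWithinAt_along (hsub t ht) (fun s _ => hF.nonneg s t r) hs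
        (hF.hasDeriv_time t ht r hr s hs)).congr_deriv ?_
      rw [← hug s (hsub t ht hs) _ (hF.nonneg s t r)]
      ring
    · exact (continuousOn_time_slice (Ψ := fun s t r => g s (X s t r)) (cont cg) ht hr).mono
        (hsub t ht)
  have repr' : ∀ t ∈ Icc 0 T, ∀ r ∈ Icc 0 r₁,
      ur t r = ur 0 (X 0 t r) * E 0 t r + ∫ s in Icc 0 t, gr s (X s t r) * E s t r := by
    intro t ht r hr
    have d1 : HasDerivWithinAt (fun r => u 0 (X 0 t r) + ∫ s in Icc 0 t, g s (X s t r))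
        (ur 0 (X 0 t r) * E 0 t r + ∫ s in Icc 0 t, gr s (X s t r) * E s t r) (Icc 0 r₁) r := by
      refine HasDerivWithinAt.fun_add (hF.hasDerivWithinAt_comp ht hr (h0 t ht)
        (hu.right 0 h0T _ (hF.nonneg 0 t r))) ?_
      refine hasDerivWithinAt_setIntegral (F := fun r s => g s (X s t r))
        (F' := fun r s => gr s (X s t r) * E s t r) isCompact_Icc (convex_Icc 0 r₁)
        (continuousOn_space_time_slice (Ψ := fun s t r => g s (X s t r)) (cont cg) ht le_rfl ht.2)
        (continuousOn_space_time_slice (Ψ := fun s t r => gr s (X s t r) * E s t r)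
          ((cont hg.cont_right).mul hF.cont_deriv) ht le_rfl ht.2) ?_ hr
      exact fun y hy s hs => hF.hasDerivWithinAt_comp ht hy hs
        (hg.right s (hsub t ht hs) _ (hF.nonneg s t y))
    have d2 := ((hu.right t ht r hr.1).mono Icc_subset_Ici_self).congr
      (fun y hy => (repr t ht y hy).symm) (repr t ht r hr).symm
    exact ((uniqueDiffOn_Icc hr₁) r hr).eq_deriv _ d2 d1
  have repr2 : ∀ t ∈ Icc 0 T, ∀ r ∈ Icc 0 r₁, ur t r = -k t r +
      (ur 0 (X 0 t r) + k 0 (X 0 t r)) * E 0 t r + ∫ s in Icc 0 t, H s (X s t r) * E s t r := by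
    intro t ht r hr
    set D : ℝ → ℝ := fun s => (kt s (X s t r) - b s (X s t r) * kr s (X s t r)) * E s t r -
      k s (X s t r) * (br s (X s t r) * E s t r) with hD
    have hDc : ContinuousOn D (Icc 0 t) := by
      refine (continuousOn_time_slice (Ψ := fun s t r =>
        (kt s (X s t r) - b s (X s t r) * kr s (X s t r)) * E s t r -
        k s (X s t r) * (br s (X s t r) * E s t r)) ?_ ht hr).mono (hsub t ht)
      exact ((((cont hk.cont_left).sub ((cont cb).mul (cont hk.cont_right))).mul hF.cont_deriv).sub
        ((cont ck).mul ((cont hb.cont_right).mul hF.cont_deriv)))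
    have hHc : ContinuousOn (fun s => H s (X s t r) * E s t r) (Icc 0 t) :=
      (continuousOn_time_slice (Ψ := fun s t r => H s (X s t r) * E s t r)
        ((cont cH).mul hF.cont_deriv) ht hr).mono (hsub t ht)
    have hparts : ∫ s in Icc 0 t, D s = k t r - k 0 (X 0 t r) * E 0 t r := by
      rw [setIntegral_Icc_eq_sub (φ := fun s => k s (X s t r) * E s t r) ht.1 ?_ hDc,
        hF.self t ht r hr, hF.self_deriv t ht r hr, mul_one]
      intro s hs
      refine ((hk.hasDerivWithinAt_along (hsub t ht) (fun s _ => hF.nonneg s t r) hs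
        (hF.hasDeriv_time t ht r hr s hs)).fun_mul
        (hF.hasDeriv_time_deriv t ht r hr s hs)).congr_deriv ?_
      simp only [hD]
      ring
    have hsplit : ∫ s in Icc 0 t, gr s (X s t r) * E s t r =
        (∫ s in Icc 0 t, H s (X s t r) * E s t r) - ∫ s in Icc 0 t, D s := by
      rw [← integral_sub (hHc.integrableOn_compact isCompact_Icc)
        (hDc.integrableOn_compact isCompact_Icc)]
      refine setIntegral_congr_fun measurableSet_Icc fun s hs => ?_
      simp only [hD, hH]
      rw [hgr s (hsub t ht hs) _ (hF.nonneg s t r)]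
      ring
    rw [repr' t ht r hr, hsplit, hparts]
    ring
  refine ⟨fun t r => -kr t r + (Q' (X 0 t r) * E 0 t r * E 0 t r +
    (ur 0 (X 0 t r) + k 0 (X 0 t r)) * E' 0 t r) +
    ∫ s in Icc 0 t, (H' s (X s t r) * E s t r * E s t r + H s (X s t r) * E' s t r), ?_, ?_⟩
  · intro t ht r hr
    have d1 : HasDerivWithinAt (fun r => -k t r) (-kr t r) (Icc 0 r₁) r :=
      ((hk.right t ht r hr.1).mono Icc_subset_Ici_self).fun_neg
    have d2 := (hF.hasDerivWithinAt_comp ht hr (h0 t ht) (hQ _ (hF.nonneg 0 t r))).fun_mul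
      (hF.hasDeriv_deriv t ht r hr 0 (h0 t ht))
    have d3 : HasDerivWithinAt (fun r => ∫ s in Icc 0 t, H s (X s t r) * E s t r)
        (∫ s in Icc 0 t, (H' s (X s t r) * E s t r * E s t r + H s (X s t r) * E' s t r))
        (Icc 0 r₁) r := by
      refine hasDerivWithinAt_setIntegral (F := fun r s => H s (X s t r) * E s t r)
        (F' := fun r s => H' s (X s t r) * E s t r * E s t r + H s (X s t r) * E' s t r)
        isCompact_Icc (convex_Icc 0 r₁)
        (continuousOn_space_time_slice (Ψ := fun s t r => H s (X s t r) * E s t r)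
          ((cont cH).mul hF.cont_deriv) ht le_rfl ht.2)
        (continuousOn_space_time_slice (Ψ := fun s t r => H' s (X s t r) * E s t r * E s t r +
          H s (X s t r) * E' s t r) ((((cont cH').mul hF.cont_deriv).mul hF.cont_deriv).add
          ((cont cH).mul hF.cont_deriv2)) ht le_rfl ht.2) ?_ hr
      exact fun y hy s hs => (hF.hasDerivWithinAt_comp ht hy hs
        (dH s (hsub t ht hs) _ (hF.nonneg s t y))).fun_mul (hF.hasDeriv_deriv t ht y hy s hs)
    exact ((d1.fun_add d2).fun_add d3).congr (fun y hy => repr2 t ht y hy) (repr2 t ht r hr)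
  · have slice0 : ∀ {Ψ : ℝ → ℝ → ℝ → ℝ}, ContinuousOn (fun q : ℝ × ℝ × ℝ => Ψ q.1 q.2.1 q.2.2)
        (Icc 0 T ×ˢ Icc 0 T ×ˢ Icc 0 r₁) →
        ContinuousOn (fun q : ℝ × ℝ => Ψ 0 q.1 q.2) (Icc 0 T ×ˢ Icc 0 r₁) := fun hΨ =>
      hΨ.comp (f := fun q : ℝ × ℝ => (0, q.1, q.2)) (by fun_prop) (fun _ hq => ⟨h0T, hq.1, hq.2⟩)
    have cX0 := slice0 hF.cont
    have hX0 : MapsTo (fun q : ℝ × ℝ => X 0 q.1 q.2) (Icc 0 T ×ˢ Icc 0 r₁) (Ici 0) :=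
      fun _ _ => hF.nonneg _ _ _
    have cQ : ContinuousOn (fun y => ur 0 y + k 0 y) (Ici 0) :=
      fun y hy => (hQ y hy).continuousWithinAt
    have c1 := (hk.cont_right.mono (prod_mono subset_rfl
      (Icc_subset_Ici_self : Icc 0 r₁ ⊆ Ici 0))).neg
    have c2 := (((hQc.comp cX0 hX0).mul (slice0 hF.cont_deriv)).mul (slice0 hF.cont_deriv)).add
      ((cQ.comp cX0 hX0).mul (slice0 hF.cont_deriv2))
    have c3 := slice0 (Ψ := fun s t r => ∫ τ in s..t,
      (H' τ (X τ t r) * E τ t r * E τ t r + H τ (X τ t r) * E' τ t r))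
      (continuousOn_integral_along (Ψ := fun s t r =>
      H' s (X s t r) * E s t r * E s t r + H s (X s t r) * E' s t r)
      ((((cont cH').mul hF.cont_deriv).mul hF.cont_deriv).add ((cont cH).mul hF.cont_deriv2)))
    refine (c1.add c2).add (c3.congr fun q hq => ?_)
    rw [integral_Icc_eq_integral_Ioc, ← intervalIntegral.integral_of_le hq.1.1]

/-- Second order regularity for the transport equation `∂_t u - b ∂_r u = g`. -/
theorem contDiffOn_two_of_transport (hT : 0 < T)
    (hb : HasPartials (Icc 0 T) (Ici 0) b bt br) (hbr : HasPartials (Icc 0 T) (Ici 0) br brt brr)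
    (hb0 : ∀ t ∈ Icc 0 T, b t 0 = 0)
    (hK : ∀ t ∈ Icc 0 T, ∀ r ∈ Ici (0 : ℝ), |bt t r - b t r * br t r| ≤ K)
    (hu : HasPartials (Icc 0 T) (Ici 0) u ut ur) (hg : HasPartials (Icc 0 T) (Ici 0) g gt gr)
    (hk : HasPartials (Icc 0 T) (Ici 0) k kt kr) (hh : HasPartials (Icc 0 T) (Ici 0) h ht hr)
    (hug : ∀ t ∈ Icc 0 T, ∀ r ∈ Ici (0 : ℝ), ut t r - b t r * ur t r = g t r)
    (hgr : ∀ t ∈ Icc 0 T, ∀ r ∈ Ici (0 : ℝ),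
      gr t r = -(kt t r - b t r * kr t r) + h t r)
    (hQ : ∀ r ∈ Ici (0 : ℝ), HasDerivWithinAt (fun y => ur 0 y + k 0 y) (Q' r) (Ici 0) r)
    (hQc : ContinuousOn Q' (Ici 0)) :
    ContDiffOn ℝ 2 (fun q : ℝ × ℝ => u q.1 q.2) (Icc 0 T ×ˢ Ici 0) := by
  have huI : UniqueDiffOn ℝ (Icc 0 T) := uniqueDiffOn_Icc hT
  have huR : UniqueDiffOn ℝ (Ici (0 : ℝ)) := uniqueDiffOn_Ici 0
  set urr : ℝ → ℝ → ℝ := fun t r => derivWithin (ur t) (Ici 0) r with hurr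
  have hloc : ∀ r₀ ∈ Ici (0 : ℝ), ∃ w : ℝ → ℝ → ℝ, (∀ t ∈ Icc 0 T, ∀ r ∈ Ico 0 (r₀ + 1),
      HasDerivWithinAt (ur t) (w t r) (Ici 0) r) ∧
      ContinuousOn (fun q : ℝ × ℝ => w q.1 q.2) (Icc 0 T ×ˢ Ico 0 (r₀ + 1)) := by
    intro r₀ hr₀
    have hpos : 0 < r₀ + 1 := by linarith [mem_Ici.1 hr₀]
    obtain ⟨X, E, E', hF⟩ := exists_isCharacteristicFlow hT.le hb hbr hb0 hK (r₀ + 1)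
    obtain ⟨w, hw, hwc⟩ :=
      hF.exists_second_deriv hT.le hpos hb hbr hu hg hk hh hug hgr hQ hQc
    refine ⟨w, fun t ht r hr => ?_, hwc.mono (prod_mono subset_rfl Ico_subset_Icc_self)⟩
    refine (hw t ht r (Ico_subset_Icc_self hr)).mono_of_mem_nhdsWithin ?_
    rw [← Ici_inter_Iic]
    exact inter_mem_nhdsWithin _ (Iic_mem_nhds hr.2)
  have dur : ∀ t ∈ Icc 0 T, ∀ r ∈ Ici (0 : ℝ), HasDerivWithinAt (ur t) (urr t r) (Ici 0) r := by
    intro t ht r hr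
    obtain ⟨w, hw, -⟩ := hloc r hr
    exact (hw t ht r ⟨hr, by linarith⟩).differentiableWithinAt.hasDerivWithinAt
  have curr : ContinuousOn (fun q : ℝ × ℝ => urr q.1 q.2) (Icc 0 T ×ˢ Ici 0) := by
    rintro ⟨t, r⟩ ⟨ht, hr⟩
    obtain ⟨w, hw, hwc⟩ := hloc r hr
    have hmem : Icc 0 T ×ˢ Ico 0 (r + 1) ∈ 𝓝[Icc 0 T ×ˢ Ici 0] (t, r) := by
      rw [nhdsWithin_prod_eq]
      refine prod_mem_prod self_mem_nhdsWithin ?_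
      rw [← Ici_inter_Iio]
      exact inter_mem_nhdsWithin _ (Iio_mem_nhds (by linarith))
    have heq : ∀ q ∈ Icc 0 T ×ˢ Ico 0 (r + 1), urr q.1 q.2 = w q.1 q.2 := fun q hq =>
      (hw q.1 hq.1 q.2 hq.2).derivWithin (huR q.2 hq.2.1)
    have hr' : r ∈ Ico 0 (r + 1) := ⟨hr, by linarith⟩
    exact ((hwc (t, r) ⟨ht, hr'⟩).congr heq (heq (t, r) ⟨ht, hr'⟩)).mono_of_mem_nhdsWithin hmem
  have cur := hu.cont_right
  have cb := hb.continuousOn (convex_Icc 0 T) (convex_Ici 0)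
  have hut : ∀ t ∈ Icc 0 T, ∀ r ∈ Ici (0 : ℝ), ut t r = g t r + b t r * ur t r :=
    fun t ht r hr => by linarith [hug t ht r hr]
  have dut : ∀ t ∈ Icc 0 T, ∀ r ∈ Ici (0 : ℝ), HasDerivWithinAt (ut t)
      (gr t r + (br t r * ur t r + b t r * urr t r)) (Ici 0) r := fun t ht r hr =>
    ((hg.right t ht r hr).fun_add ((hb.right t ht r hr).fun_mul (dur t ht r hr))).congr
      (fun y hy => hut t ht y hy) (hut t ht r hr)
  have cutr : ContinuousOn (fun q : ℝ × ℝ => gr q.1 q.2 +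
      (br q.1 q.2 * ur q.1 q.2 + b q.1 q.2 * urr q.1 q.2)) (Icc 0 T ×ˢ Ici 0) :=
    hg.cont_right.add ((hb.cont_right.mul cur).add (cb.mul curr))
  have pur : HasPartials (Icc 0 T) (Ici 0) ur
      (fun t r => gr t r + (br t r * ur t r + b t r * urr t r)) urr :=
    ⟨fun t ht r hr => hu.hasDerivWithinAt_right_left hT (convex_Ici 0) huR dut cutr ht hr,
      dur, cutr, curr⟩
  have sur := pur.contDiffOn_one (convex_Icc 0 T) (convex_Ici 0) huI huR
  have sut : ContDiffOn ℝ 1 (fun q : ℝ × ℝ => ut q.1 q.2) (Icc 0 T ×ˢ Ici 0) := by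
    refine ((hg.contDiffOn_one (convex_Icc 0 T) (convex_Ici 0) huI huR).add
      ((hb.contDiffOn_one (convex_Icc 0 T) (convex_Ici 0) huI huR).mul sur)).congr ?_
    exact fun q hq => hut q.1 hq.1 q.2 hq.2
  exact_mod_cast hu.contDiffOn (n := 1) (convex_Icc 0 T) (convex_Ici 0) huI huR
    (by exact_mod_cast sut) (by exact_mod_cast sur)

end

/-! ### The energy balance at a fixed time -/

theorem norm_sq_E3 (v : E3) : ‖v‖ ^ 2 = v 0 ^ 2 + v 1 ^ 2 + v 2 ^ 2 := by
  rw [EuclideanSpace.real_norm_sq_eq, Fin.sum_univ_three]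

theorem bracket_pos (v : E3) : 0 < bracket v := Real.sqrt_pos.2 (by positivity)

theorem bracket_sq (v : E3) : bracket v ^ 2 = 1 + v 0 ^ 2 + v 1 ^ 2 + v 2 ^ 2 := by
  rw [bracket, Real.sq_sqrt (by positivity), norm_sq_E3]
  ring

theorem continuous_bracket : Continuous bracket := by
  unfold bracket
  fun_prop

theorem hasFDerivAt_bracket (v : E3) :
    HasFDerivAt bracket ((1 / bracket v) • innerSL ℝ v) v := by
  have h := ((hasStrictFDerivAt_norm_sq v).hasFDerivAt.const_add 1).sqrt
    (by positivity : (1 + ‖v‖ ^ 2 : ℝ) ≠ 0)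
  refine h.congr_fderiv ?_
  ext w
  simp only [bracket, smul_apply, smul_eq_mul, nsmul_eq_mul, Nat.cast_ofNat,
    innerSL_apply_apply]
  field_simp

theorem hasFDerivAt_coord (i : Fin 3) (v : E3) :
    HasFDerivAt (fun v : E3 => v i) (EuclideanSpace.proj (𝕜 := ℝ) i : E3 →L[ℝ] ℝ) v :=
  (EuclideanSpace.proj (𝕜 := ℝ) i : E3 →L[ℝ] ℝ).hasFDerivAt

theorem integrable_mul_of_support {φ d : E3 → ℝ} {K : Set E3} (hK : IsCompact K)
    (hφ : Continuous φ) (hd : Continuous d) (h0 : ∀ v, v ∉ K → d v = 0) :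
    Integrable (fun v => φ v * d v) :=
  (hφ.mul hd).integrable_of_hasCompactSupport
    (HasCompactSupport.intro hK fun v hv => by simp [h0 v hv])

theorem fderiv_eq_zero_of_support {g : E3 → ℝ} {K : Set E3} (hK : IsCompact K)
    (h0 : ∀ v, v ∉ K → g v = 0) {v : E3} (hv : v ∉ K) : fderiv ℝ g v = 0 := by
  have : g =ᶠ[𝓝 v] fun _ => 0 :=
    eventually_of_mem (hK.isClosed.isOpen_compl.mem_nhds hv) fun w hw => h0 w hw
  rw [this.fderiv_eq]
  simp

theorem integral_mul_fderiv_eq {ψ ψ' g : E3 → ℝ} {e : E3} {K : Set E3} (hK : IsCompact K)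
    (hψ : Differentiable ℝ ψ) (hψ' : ∀ v, fderiv ℝ ψ v e = ψ' v) (hc : Continuous ψ')
    (hg : ContDiff ℝ 1 g) (h0 : ∀ v, v ∉ K → g v = 0) :
    ∫ v, ψ v * fderiv ℝ g v e = -∫ v, ψ' v * g v := by
  simp only [← hψ']
  refine integral_mul_fderiv_eq_neg_fderiv_mul_of_integrable ?_ ?_ ?_
    (fun v _ => hψ v) (fun v _ => hg.differentiable one_ne_zero v)
  · simp only [hψ']
    exact integrable_mul_of_support hK hc hg.continuous h0
  · exact integrable_mul_of_support hK hψ.continuous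
      ((hg.continuous_fderiv one_ne_zero).clm_apply continuous_const)
      (fun v hv => by simp [fderiv_eq_zero_of_support hK h0 hv])
  · exact integrable_mul_of_support hK hψ.continuous hg.continuous h0

/-- The infinitesimal form of invariance under a one-parameter family of rotations. -/
theorem SphericallySymmetric.fderiv_eq_zero {h : E3 → E3 → ℝ} (hs : SphericallySymmetric h)
    {A : ℝ → Matrix (Fin 3) (Fin 3) ℝ} (hA : ∀ θ, A θ ∈ Matrix.specialOrthogonalGroup (Fin 3) ℝ)
    {Ω : E3 → E3} (h0 : A 0 = 1)
    (hΩ : ∀ v, HasDerivAt (fun θ => Matrix.toEuclideanLin (A θ) v) (Ω v) 0) {x v : E3}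
    (hd : DifferentiableAt ℝ (fun z : E3 × E3 => h z.1 z.2) (x, v)) :
    fderiv ℝ (fun z : E3 × E3 => h z.1 z.2) (x, v) (Ω x, Ω v) = 0 := by
  have h1 : ∀ w : E3, Matrix.toEuclideanLin (A 0) w = w := fun w => by
    rw [h0]
    ext i
    simp
  have hd' : HasFDerivAt (fun z : E3 × E3 => h z.1 z.2)
      (fderiv ℝ (fun z : E3 × E3 => h z.1 z.2) (x, v))
      (Matrix.toEuclideanLin (A 0) x, Matrix.toEuclideanLin (A 0) v) := by
    rw [h1, h1]
    exact hd.hasFDerivAt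
  have h2 := hd'.comp_hasDerivAt (0 : ℝ) ((hΩ x).prodMk (hΩ v))
  have h3 : ((fun z : E3 × E3 => h z.1 z.2) ∘ fun θ =>
      (Matrix.toEuclideanLin (A θ) x, Matrix.toEuclideanLin (A θ) v)) = fun _ => h x v := by
    funext θ
    exact hs (A θ) (hA θ) x v
  rw [h3] at h2
  exact h2.unique (hasDerivAt_const _ _)

/-- The standard basis of `E3`. -/
noncomputable abbrev basisE3 (i : Fin 3) : E3 := EuclideanSpace.single i 1

theorem sum_basisE3 (v : E3) : v = v 0 • basisE3 0 + v 1 • basisE3 1 + v 2 • basisE3 2 := by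
  ext i
  fin_cases i <;> simp

theorem SphericallySymmetric.rotation_one {h : E3 → E3 → ℝ} (hs : SphericallySymmetric h)
    {x v : E3} (hd : DifferentiableAt ℝ (fun z : E3 × E3 => h z.1 z.2) (x, v)) :
    fderiv ℝ (fun z : E3 × E3 => h z.1 z.2) (x, v)
      (x 0 • basisE3 1 - x 1 • basisE3 0, v 0 • basisE3 1 - v 1 • basisE3 0) = 0 := by
  refine hs.fderiv_eq_zero (A := fun θ => !![Real.cos θ, -Real.sin θ, 0;
    Real.sin θ, Real.cos θ, 0; 0, 0, 1]) (Ω := fun v => v 0 • basisE3 1 - v 1 • basisE3 0)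
    (fun θ => ?_) ?_ (fun v => ?_) hd
  · rw [Matrix.mem_specialOrthogonalGroup_iff, Matrix.mem_orthogonalGroup_iff]
    constructor
    · ext i k
      fin_cases i <;> fin_cases k <;> simp [Matrix.mul_apply, Fin.sum_univ_three] <;>
        nlinarith [Real.sin_sq_add_cos_sq θ]
    · simp [Matrix.det_fin_three]
      nlinarith [Real.sin_sq_add_cos_sq θ]
  · ext i k
    fin_cases i <;> fin_cases k <;> simp
  · have h1 : (fun θ => Matrix.toEuclideanLin !![Real.cos θ, -Real.sin θ, 0;
        Real.sin θ, Real.cos θ, 0; 0, 0, 1] v) = fun θ =>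
        Real.cos θ • (v 0 • basisE3 0 + v 1 • basisE3 1) +
        Real.sin θ • (v 0 • basisE3 1 - v 1 • basisE3 0) + v 2 • basisE3 2 := by
      funext θ
      ext i
      fin_cases i <;> simp [Matrix.toLpLin_apply, dotProduct, Fin.sum_univ_three]; ring
    rw [h1]
    have h2 := ((((Real.hasDerivAt_cos 0).smul_const (v 0 • basisE3 0 + v 1 • basisE3 1)).fun_add
      ((Real.hasDerivAt_sin 0).smul_const (v 0 • basisE3 1 - v 1 • basisE3 0))).add_const
      (v 2 • basisE3 2))
    simpa using h2

theorem SphericallySymmetric.rotation_two {h : E3 → E3 → ℝ} (hs : SphericallySymmetric h)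
    {x v : E3} (hd : DifferentiableAt ℝ (fun z : E3 × E3 => h z.1 z.2) (x, v)) :
    fderiv ℝ (fun z : E3 × E3 => h z.1 z.2) (x, v)
      (x 0 • basisE3 2 - x 2 • basisE3 0, v 0 • basisE3 2 - v 2 • basisE3 0) = 0 := by
  refine hs.fderiv_eq_zero (A := fun θ => !![Real.cos θ, 0, -Real.sin θ;
    0, 1, 0; Real.sin θ, 0, Real.cos θ]) (Ω := fun v => v 0 • basisE3 2 - v 2 • basisE3 0)
    (fun θ => ?_) ?_ (fun v => ?_) hd
  · rw [Matrix.mem_specialOrthogonalGroup_iff, Matrix.mem_orthogonalGroup_iff]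
    constructor
    · ext i k
      fin_cases i <;> fin_cases k <;> simp [Matrix.mul_apply, Fin.sum_univ_three] <;>
        nlinarith [Real.sin_sq_add_cos_sq θ]
    · simp [Matrix.det_fin_three]
      nlinarith [Real.sin_sq_add_cos_sq θ]
  · ext i k
    fin_cases i <;> fin_cases k <;> simp
  · have h1 : (fun θ => Matrix.toEuclideanLin !![Real.cos θ, 0, -Real.sin θ;
        0, 1, 0; Real.sin θ, 0, Real.cos θ] v) = fun θ =>
        Real.cos θ • (v 0 • basisE3 0 + v 2 • basisE3 2) +
        Real.sin θ • (v 0 • basisE3 2 - v 2 • basisE3 0) + v 1 • basisE3 1 := by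
      funext θ
      ext i
      fin_cases i <;> simp [Matrix.toLpLin_apply, dotProduct, Fin.sum_univ_three]; ring
    rw [h1]
    have h2 := ((((Real.hasDerivAt_cos 0).smul_const (v 0 • basisE3 0 + v 2 • basisE3 2)).fun_add
      ((Real.hasDerivAt_sin 0).smul_const (v 0 • basisE3 2 - v 2 • basisE3 0))).add_const
      (v 1 • basisE3 1))
    simpa using h2

theorem integral_bracket_mul_fderiv {g : E3 → ℝ} {K : Set E3} (hK : IsCompact K)
    (hg : ContDiff ℝ 1 g) (h0 : ∀ v, v ∉ K → g v = 0) (i : Fin 3) :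
    ∫ v, bracket v * v i * fderiv ℝ g v (basisE3 i) =
      -((∫ v, bracket v * g v) + ∫ v, v i ^ 2 / bracket v * g v) := by
  have hd : ∀ v : E3, HasFDerivAt (fun v : E3 => bracket v * v i) _ v := fun v =>
    (hasFDerivAt_bracket v).mul (hasFDerivAt_coord i v)
  have hc : Continuous fun v : E3 => v i ^ 2 / bracket v :=
    Continuous.div (by fun_prop) continuous_bracket fun v => (bracket_pos v).ne'
  rw [integral_mul_fderiv_eq (ψ' := fun v => bracket v + v i ^ 2 / bracket v) hK
    (fun v => (hd v).differentiableAt) (fun v => ?_) (continuous_bracket.add hc) hg h0]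
  · rw [← integral_add (integrable_mul_of_support hK continuous_bracket hg.continuous h0)
      (integrable_mul_of_support hK hc hg.continuous h0)]
    simp only [add_mul]
  · rw [(hd v).fderiv]
    simp [EuclideanSpace.inner_single_right]
    ring

theorem integral_coord_mul_coord_mul_fderiv {g : E3 → ℝ} {K : Set E3} (hK : IsCompact K)
    (hg : ContDiff ℝ 1 g) (h0 : ∀ v, v ∉ K → g v = 0) {i : Fin 3} (hi : i ≠ 0) :
    ∫ v, v 0 * v i * fderiv ℝ g v (basisE3 i) = -∫ v, v 0 * g v := by
  have hd : ∀ v : E3, HasFDerivAt (fun v : E3 => v 0 * v i) _ v := fun v =>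
    (hasFDerivAt_coord 0 v).mul (hasFDerivAt_coord i v)
  refine integral_mul_fderiv_eq (ψ' := fun v => v 0) hK
    (fun v => (hd v).differentiableAt) (fun v => ?_) (by fun_prop) hg h0
  rw [(hd v).fderiv]
  simp [hi.symm]

theorem integral_coord_sq_mul_fderiv {g : E3 → ℝ} {K : Set E3} (hK : IsCompact K)
    (hg : ContDiff ℝ 1 g) (h0 : ∀ v, v ∉ K → g v = 0) {i : Fin 3} (hi : i ≠ 0) :
    ∫ v, v i ^ 2 * fderiv ℝ g v (basisE3 0) = 0 := by
  have hd : ∀ v : E3, HasFDerivAt (fun v : E3 => v i ^ 2) _ v := fun v =>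
    (hasFDerivAt_coord i v).pow 2
  rw [integral_mul_fderiv_eq (ψ' := fun v => 0) hK
    (fun v => (hd v).differentiableAt) (fun v => ?_) (by fun_prop) hg h0]
  · simp
  · rw [(hd v).fderiv]
    simp [hi]

/-- The energy balance: the Vlasov equation at `x = r e₁`, integrated against `⟨v⟩`. -/
theorem energy_balance {h : E3 → E3 → ℝ} {K : Set (E3 × E3)} (hK : IsCompact K)
    (hsupp : ∀ x v, (x, v) ∉ K → h x v = 0) (hh : ContDiff ℝ 1 fun z : E3 × E3 => h z.1 z.2)
    (hs : SphericallySymmetric h) {r α β c : ℝ} (hr : 0 < r) {ft : E3 → ℝ}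
    (hV : ∀ v, ft v + fderiv ℝ (fun y => h y v) (r • e₁) ((α / bracket v) • v - β • e₁) +
      fderiv ℝ (fun w => h (r • e₁) w) v ((c * v 0) • e₁ + (β / r) • v) = 0) :
    ∫ v, bracket v * ft v = β * (∫ v, bracket v * fderiv ℝ (fun y => h y v) (r • e₁) e₁) -
      α * ((∫ v, v 0 * fderiv ℝ (fun y => h y v) (r • e₁) e₁) + 2 / r * ∫ v, v 0 * h (r • e₁) v) +
      c * ((∫ v, bracket v * h (r • e₁) v) + ∫ v, v 0 ^ 2 / bracket v * h (r • e₁) v) +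
      β / r * (4 * (∫ v, bracket v * h (r • e₁) v) - ∫ v, (bracket v)⁻¹ * h (r • e₁) v) := by
  set x : E3 := r • e₁ with hx
  set H : E3 × E3 → ℝ := fun z => h z.1 z.2 with hH
  have hx0 : x 0 = r := by simp [hx, e₁]
  have hx1 : x 1 = 0 := by simp [hx, e₁]
  have hx2 : x 2 = 0 := by simp [hx, e₁]
  have hKv : IsCompact (Prod.snd '' K) := hK.image continuous_snd
  have h0 : ∀ y v, v ∉ Prod.snd '' K → h y v = 0 := fun y v hv =>
    hsupp y v fun hmem => hv ⟨(y, v), hmem, rfl⟩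
  have hd : ∀ z, HasFDerivAt H (fderiv ℝ H z) z := fun z =>
    (hh.differentiable one_ne_zero z).hasFDerivAt
  have hdx : ∀ v w, fderiv ℝ (fun y => h y v) x w = fderiv ℝ H (x, v) (w, 0) := by
    intro v w
    have : HasFDerivAt (fun y => h y v) _ x :=
      HasFDerivAt.comp (g := H) (f := fun y => (y, v)) x (hd (x, v))
        (hasFDerivAt_prodMk_left (𝕜 := ℝ) x v)
    rw [this.fderiv]
    simp
  have hdv : ∀ v w, fderiv ℝ (fun w => h x w) v w = fderiv ℝ H (x, v) (0, w) := by
    intro v w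
    have : HasFDerivAt (fun w => h x w) _ v :=
      HasFDerivAt.comp (g := H) v (hd (x, v)) (hasFDerivAt_prodMk_right x v)
    rw [this.fderiv]
    simp
  have hg : ContDiff ℝ 1 (h x) := hh.comp (contDiff_prodMk_right x)
  have cH := hh.continuous_fderiv one_ne_zero
  set X0 : E3 → ℝ := fun v => fderiv ℝ (fun y => h y v) x e₁ with hX0
  set V : Fin 3 → E3 → ℝ := fun i v => fderiv ℝ (h x) v (basisE3 i) with hVdef
  have cX0 : Continuous X0 := by
    simp only [hX0, hdx]
    exact (cH.comp (Continuous.prodMk_right x)).clm_apply continuous_const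
  have cV : ∀ i, Continuous (V i) := fun i =>
    (hg.continuous_fderiv one_ne_zero).clm_apply continuous_const
  have zX0 : ∀ v, v ∉ Prod.snd '' K → X0 v = 0 := by
    intro v hv
    have : (fun y => h y v) = fun _ => 0 := funext fun y => h0 y v hv
    simp [hX0, this]
  have zV : ∀ i v, v ∉ Prod.snd '' K → V i v = 0 := fun i v hv => by
    simp [hVdef, fderiv_eq_zero_of_support hKv (h0 x) hv]
  have rot1 : ∀ v : E3, r * fderiv ℝ (fun y => h y v) x (basisE3 1) =
      v 1 * V 0 v - v 0 * V 1 v := by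
    intro v
    have := hs.rotation_one (hd (x, v)).differentiableAt
    have e : ((x 0 • basisE3 1 - x 1 • basisE3 0, v 0 • basisE3 1 - v 1 • basisE3 0) : E3 × E3) =
        r • (basisE3 1, 0) + v 0 • (0, basisE3 1) - v 1 • (0, basisE3 0) := by
      simp [hx0, hx1]
    rw [e, map_sub, map_add, map_smul, map_smul, map_smul] at this
    simp only [hVdef, hdx, hdv, smul_eq_mul] at this ⊢
    linarith
  have rot2 : ∀ v : E3, r * fderiv ℝ (fun y => h y v) x (basisE3 2) =
      v 2 * V 0 v - v 0 * V 2 v := by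
    intro v
    have := hs.rotation_two (hd (x, v)).differentiableAt
    have e : ((x 0 • basisE3 2 - x 2 • basisE3 0, v 0 • basisE3 2 - v 2 • basisE3 0) : E3 × E3) =
        r • (basisE3 2, 0) + v 0 • (0, basisE3 2) - v 2 • (0, basisE3 0) := by
      simp [hx0, hx2]
    rw [e, map_sub, map_add, map_smul, map_smul, map_smul] at this
    simp only [hVdef, hdx, hdv, smul_eq_mul] at this ⊢
    linarith
  have expand : ∀ (ℓ : E3 →L[ℝ] ℝ) (v : E3),
      ℓ v = v 0 * ℓ (basisE3 0) + v 1 * ℓ (basisE3 1) + v 2 * ℓ (basisE3 2) := by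
    intro ℓ v
    conv_lhs => rw [sum_basisE3 v]
    simp only [map_add, map_smul, smul_eq_mul]
  set coef : Fin 9 → ℝ := ![β, -α, α / r, -(α / r), α / r, -(α / r), -(c + β / r), -(β / r),
    -(β / r)] with hcoef
  set term : Fin 9 → E3 → ℝ := ![fun v => bracket v * X0 v, fun v => v 0 * X0 v,
    fun v => v 0 * v 1 * V 1 v, fun v => v 1 ^ 2 * V 0 v, fun v => v 0 * v 2 * V 2 v,
    fun v => v 2 ^ 2 * V 0 v, fun v => bracket v * v 0 * V 0 v, fun v => bracket v * v 1 * V 1 v,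
    fun v => bracket v * v 2 * V 2 v] with hterm
  have cb := continuous_bracket
  have cc : ∀ i : Fin 3, Continuous fun v : E3 => v i := fun i => by fun_prop
  have hint : ∀ i, Integrable (term i) := by
    intro i
    fin_cases i
    · exact integrable_mul_of_support hKv cb cX0 zX0
    · exact integrable_mul_of_support hKv (cc 0) cX0 zX0
    · exact integrable_mul_of_support hKv ((cc 0).mul (cc 1)) (cV 1) (zV 1)
    · exact integrable_mul_of_support hKv ((cc 1).pow 2) (cV 0) (zV 0)
    · exact integrable_mul_of_support hKv ((cc 0).mul (cc 2)) (cV 2) (zV 2)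
    · exact integrable_mul_of_support hKv ((cc 2).pow 2) (cV 0) (zV 0)
    · exact integrable_mul_of_support hKv (cb.mul (cc 0)) (cV 0) (zV 0)
    · exact integrable_mul_of_support hKv (cb.mul (cc 1)) (cV 1) (zV 1)
    · exact integrable_mul_of_support hKv (cb.mul (cc 2)) (cV 2) (zV 2)
  have pointwise : ∀ v, bracket v * ft v = ∑ i, coef i * term i v := by
    intro v
    have hb := (bracket_pos v).ne'
    have h1 := hV v
    rw [map_sub, map_smul, map_smul, map_add, map_smul, map_smul,
      expand (fderiv ℝ (fun y => h y v) x) v, expand (fderiv ℝ (fun w => h x w) v) v] at h1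
    simp only [smul_eq_mul] at h1
    have h2 := rot1 v
    have h3 := rot2 v
    change ft v + (α / bracket v * (v 0 * X0 v + _ + _) - β * X0 v) + (c * v 0 * V 0 v +
      β / r * (v 0 * V 0 v + v 1 * V 1 v + v 2 * V 2 v)) = 0 at h1
    simp only [hcoef, hterm, Fin.sum_univ_succ, Fin.sum_univ_zero, Matrix.cons_val_zero,
      Matrix.cons_val_succ, add_zero]
    have h2' : fderiv ℝ (fun y => h y v) x (basisE3 1) = (v 1 * V 0 v - v 0 * V 1 v) / r := by
      rw [eq_div_iff hr.ne', ← h2, mul_comm]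
    have h3' : fderiv ℝ (fun y => h y v) x (basisE3 2) = (v 2 * V 0 v - v 0 * V 2 v) / r := by
      rw [eq_div_iff hr.ne', ← h3, mul_comm]
    rw [h2', h3'] at h1
    have h4 : ft v = -(α / bracket v * (v 0 * X0 v + v 1 * ((v 1 * V 0 v - v 0 * V 1 v) / r) +
      v 2 * ((v 2 * V 0 v - v 0 * V 2 v) / r)) - β * X0 v) - (c * v 0 * V 0 v +
      β / r * (v 0 * V 0 v + v 1 * V 1 v + v 2 * V 2 v)) := by linarith
    rw [h4]
    field_simp
    ring
  have hsum : ∫ v, bracket v * ft v = ∑ i, coef i * ∫ v, term i v := by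
    simp only [pointwise]
    rw [integral_finsetSum _ fun i _ => (hint i).const_mul _]
    simp only [integral_const_mul]
  have hpress : (∫ v, v 0 ^ 2 / bracket v * h x v) + (∫ v, v 1 ^ 2 / bracket v * h x v) +
      (∫ v, v 2 ^ 2 / bracket v * h x v) =
      (∫ v, bracket v * h x v) - ∫ v, (bracket v)⁻¹ * h x v := by
    have ci : ∀ i : Fin 3, Integrable fun v : E3 => v i ^ 2 / bracket v * h x v := fun i =>
      integrable_mul_of_support hKv (((cc i).pow 2).div cb fun v => (bracket_pos v).ne')
        hg.continuous (h0 x)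
    rw [← integral_add (ci 0) (ci 1), ← integral_add ((ci 0).fun_add (ci 1)) (ci 2),
      ← integral_sub (integrable_mul_of_support hKv cb hg.continuous (h0 x))
      (integrable_mul_of_support (φ := fun v => (bracket v)⁻¹) hKv
        (cb.inv₀ fun v => (bracket_pos v).ne') hg.continuous (h0 x))]
    refine integral_congr_ae (Eventually.of_forall fun v => ?_)
    have hb := (bracket_pos v).ne'
    have hb2 := bracket_sq v
    field_simp
    linear_combination -h x v * hb2
  have i1 := integral_coord_mul_coord_mul_fderiv hKv hg (h0 x) (i := 1) (by decide)
  have i2 := integral_coord_mul_coord_mul_fderiv hKv hg (h0 x) (i := 2) (by decide)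
  have i3 := integral_coord_sq_mul_fderiv hKv hg (h0 x) (i := 1) (by decide)
  have i4 := integral_coord_sq_mul_fderiv hKv hg (h0 x) (i := 2) (by decide)
  have i5 := integral_bracket_mul_fderiv hKv hg (h0 x) 0
  have i6 := integral_bracket_mul_fderiv hKv hg (h0 x) 1
  have i7 := integral_bracket_mul_fderiv hKv hg (h0 x) 2
  rw [hsum]
  simp only [hcoef, hterm, Fin.sum_univ_succ, Fin.sum_univ_zero, Matrix.cons_val_zero,
    Matrix.cons_val_succ, add_zero]
  simp only [hVdef]
  rw [i1, i2, i3, i4, i5, i6, i7]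
  linear_combination (β / r) * hpress

/-! ### Velocity moments -/

/-- The velocity moment of `f` with weight `φ`, on the ray spanned by `e₁`. -/
noncomputable def moment (φ : E3 → ℝ) (f : ℝ → E3 → E3 → ℝ) (t r : ℝ) : ℝ :=
  ∫ v, φ v * f t (r • e₁) v

section Moments

variable {J : Set ℝ} {f : ℝ → E3 → E3 → ℝ}

theorem hasDerivWithinAt_time (hf : ContDiffOn ℝ 1 (fun q : ℝ × E3 × E3 => f q.1 q.2.1 q.2.2)
      (J ×ˢ univ)) {t : ℝ} (ht : t ∈ J) (x v : E3) :
    HasDerivWithinAt (fun s => f s x v)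
      (fderivWithin ℝ (fun q : ℝ × E3 × E3 => f q.1 q.2.1 q.2.2) (J ×ˢ univ) (t, x, v)
        (1, 0)) J t := by
  have h := (hf.differentiableOn one_ne_zero (t, x, v) ⟨ht, mem_univ _⟩).hasFDerivWithinAt
  have hm : MapsTo (fun s => (s, x, v)) J (J ×ˢ univ) := fun _ hs => ⟨hs, mem_univ _⟩
  exact h.comp_hasDerivWithinAt t
    ((hasDerivWithinAt_id t J).prodMk (hasDerivWithinAt_const t J (x, v))) hm

theorem hasFDerivAt_space (hf : ContDiffOn ℝ 1 (fun q : ℝ × E3 × E3 => f q.1 q.2.1 q.2.2)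
      (J ×ˢ univ)) {t : ℝ} (ht : t ∈ J) (x v : E3) :
    HasFDerivAt (fun y => f t y v)
      ((fderivWithin ℝ (fun q : ℝ × E3 × E3 => f q.1 q.2.1 q.2.2) (J ×ˢ univ) (t, x, v)).comp
        ((ContinuousLinearMap.inr ℝ ℝ (E3 × E3)).comp (ContinuousLinearMap.inl ℝ E3 E3))) x := by
  have h := (hf.differentiableOn one_ne_zero (t, x, v) ⟨ht, mem_univ _⟩).hasFDerivWithinAt
  have hm : MapsTo (fun y : E3 => (t, y, v)) univ (J ×ˢ univ) := fun _ _ => ⟨ht, mem_univ _⟩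
  have h2 : HasFDerivAt (fun y : E3 => (t, y, v))
      ((ContinuousLinearMap.inr ℝ ℝ (E3 × E3)).comp (ContinuousLinearMap.inl ℝ E3 E3)) x :=
    HasFDerivAt.comp (f := fun y => (y, v)) (g := fun z : E3 × E3 => (t, z)) x
      (hasFDerivAt_prodMk_right (𝕜 := ℝ) t (x, v)) (hasFDerivAt_prodMk_left (𝕜 := ℝ) x v)
  rw [← hasFDerivWithinAt_univ] at h2 ⊢
  exact h.comp x h2 hm

theorem contDiff_slice (hf : ContDiffOn ℝ 1 (fun q : ℝ × E3 × E3 => f q.1 q.2.1 q.2.2)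
      (J ×ˢ univ)) {t : ℝ} (ht : t ∈ J) : ContDiff ℝ 1 fun z : E3 × E3 => f t z.1 z.2 :=
  contDiffOn_univ.1 (hf.comp (f := fun z : E3 × E3 => (t, z)) (by fun_prop)
    (fun _ _ => ⟨ht, mem_univ _⟩))

variable {K : Set (E3 × E3)} {φ : E3 → ℝ}

theorem hasPartials_moment (hJ : Convex ℝ J) (hJu : UniqueDiffOn ℝ J)
    (hf : ContDiffOn ℝ 1 (fun q : ℝ × E3 × E3 => f q.1 q.2.1 q.2.2) (J ×ˢ univ))
    (hK : IsCompact K) (h0 : ∀ t ∈ J, ∀ x v, (x, v) ∉ K → f t x v = 0) (hφ : Continuous φ) :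
    HasPartials J univ (moment φ f)
      (fun t r => ∫ v, φ v * derivWithin (fun s => f s (r • e₁) v) J t)
      (fun t r => ∫ v, φ v * fderiv ℝ (fun y => f t y v) (r • e₁) e₁) := by
  set F : ℝ × E3 × E3 → ℝ := fun q => f q.1 q.2.1 q.2.2 with hF
  set D := fderivWithin ℝ F (J ×ˢ univ) with hD
  have hDc : ContinuousOn D (J ×ˢ univ) :=
    hf.continuousOn_fderivWithin (hJu.prod uniqueDiffOn_univ) le_rfl
  have hKv : IsCompact (Prod.snd '' K) := hK.image continuous_snd
  have h0' : ∀ t ∈ J, ∀ x, ∀ v ∉ Prod.snd '' K, f t x v = 0 := fun t ht x v hv =>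
    h0 t ht x v fun hmem => hv ⟨(x, v), hmem, rfl⟩
  have hT : ∀ t ∈ J, ∀ x v, HasDerivWithinAt (fun s => f s x v) (D (t, x, v) (1, 0)) J t :=
    fun t ht x v => hasDerivWithinAt_time hf ht x v
  have hX : ∀ t ∈ J, ∀ r v, HasDerivAt (fun r : ℝ => f t (r • e₁) v)
      (D (t, r • e₁, v) (0, e₁, 0)) r := by
    intro t ht r v
    have h1 : HasDerivAt (fun r : ℝ => r • e₁) e₁ r := by
      simpa using (hasDerivAt_id r).smul_const e₁
    exact (hasFDerivAt_space hf ht (r • e₁) v).comp_hasDerivAt r h1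
  have eT : ∀ t ∈ J, ∀ x v, derivWithin (fun s => f s x v) J t = D (t, x, v) (1, 0) :=
    fun t ht x v => (hT t ht x v).derivWithin (hJu t ht)
  have eX : ∀ t ∈ J, ∀ x v, fderiv ℝ (fun y => f t y v) x e₁ = D (t, x, v) (0, e₁, 0) := by
    intro t ht x v
    rw [(hasFDerivAt_space hf ht x v).fderiv]
    simp [hD, hF]
  have iM : ∀ t ∈ J, ∀ r, moment φ f t r = ∫ v in Prod.snd '' K, φ v * f t (r • e₁) v :=
    fun t ht r => (setIntegral_eq_integral_of_forall_compl_eq_zero fun v hv => by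
      rw [h0' t ht _ v hv, mul_zero]).symm
  have iT : ∀ t ∈ J, ∀ r : ℝ, ∫ v, φ v * derivWithin (fun s => f s (r • e₁) v) J t =
      ∫ v in Prod.snd '' K, φ v * D (t, r • e₁, v) (1, 0) := by
    intro t ht r
    rw [← setIntegral_eq_integral_of_forall_compl_eq_zero (s := Prod.snd '' K)]
    · simp only [eT t ht]
    · intro v hv
      rw [derivWithin_congr (f := fun _ => 0) (fun s hs => h0' s hs _ v hv) (h0' t ht _ v hv)]
      simp
  have iX : ∀ t ∈ J, ∀ r : ℝ, ∫ v, φ v * fderiv ℝ (fun y => f t y v) (r • e₁) e₁ =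
      ∫ v in Prod.snd '' K, φ v * D (t, r • e₁, v) (0, e₁, 0) := by
    intro t ht r
    rw [← setIntegral_eq_integral_of_forall_compl_eq_zero (s := Prod.snd '' K)]
    · simp only [eX t ht]
    · intro v hv
      have : (fun y => f t y v) = fun _ => 0 := funext fun y => h0' t ht y v hv
      simp [this]
  have cont : ∀ w, ContinuousOn (fun z : (ℝ × ℝ) × E3 => φ z.2 * D (z.1.1, z.1.2 • e₁, z.2) w)
      ((J ×ˢ univ) ×ˢ (Prod.snd '' K)) := by
    intro w
    refine (hφ.comp continuous_snd).continuousOn.mul (ContinuousOn.clm_apply ?_ continuousOn_const)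
    exact hDc.comp (f := fun z : (ℝ × ℝ) × E3 => (z.1.1, z.1.2 • e₁, z.2)) (by fun_prop)
      (fun z hz => ⟨hz.1.1, mem_univ _⟩)
  have contF : ContinuousOn (fun z : (ℝ × ℝ) × E3 => φ z.2 * f z.1.1 (z.1.2 • e₁) z.2)
      ((J ×ˢ univ) ×ˢ (Prod.snd '' K)) := by
    refine (hφ.comp continuous_snd).continuousOn.mul ?_
    exact hf.continuousOn.comp (f := fun z : (ℝ × ℝ) × E3 => (z.1.1, z.1.2 • e₁, z.2))
      (by fun_prop) (fun z hz => ⟨hz.1.1, mem_univ _⟩)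
  have left_comp : ∀ {G : (ℝ × ℝ) × E3 → ℝ}, ContinuousOn G ((J ×ˢ univ) ×ˢ (Prod.snd '' K)) →
      ∀ r, ContinuousOn (fun z : ℝ × E3 => G ((z.1, r), z.2)) (J ×ˢ (Prod.snd '' K)) :=
    fun hG r => hG.comp (f := fun z : ℝ × E3 => ((z.1, r), z.2)) (by fun_prop)
      (fun z hz => ⟨⟨hz.1, mem_univ _⟩, hz.2⟩)
  have right_comp : ∀ {G : (ℝ × ℝ) × E3 → ℝ}, ContinuousOn G ((J ×ˢ univ) ×ˢ (Prod.snd '' K)) →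
      ∀ t ∈ J, ContinuousOn (fun z : ℝ × E3 => G ((t, z.1), z.2)) (univ ×ˢ (Prod.snd '' K)) :=
    fun hG t ht => hG.comp (f := fun z : ℝ × E3 => ((t, z.1), z.2)) (by fun_prop)
      (fun z hz => ⟨⟨ht, mem_univ _⟩, hz.2⟩)
  refine ⟨fun t ht r _ => ?_, fun t ht r _ => ?_, ?_, ?_⟩
  · rw [iT t ht r]
    refine HasDerivWithinAt.congr ?_ (fun s hs => iM s hs r) (iM t ht r)
    exact hasDerivWithinAt_setIntegral (F := fun s v => φ v * f s (r • e₁) v)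
      (F' := fun s v => φ v * D (s, r • e₁, v) (1, 0)) hKv hJ (left_comp contF r)
      (left_comp (cont (1, 0)) r) (fun s hs v _ => (hT s hs _ v).const_mul _) ht
  · rw [iX t ht r]
    refine HasDerivWithinAt.congr ?_ (fun s _ => iM t ht s) (iM t ht r)
    exact hasDerivWithinAt_setIntegral (F := fun r v => φ v * f t (r • e₁) v)
      (F' := fun r v => φ v * D (t, r • e₁, v) (0, e₁, 0)) hKv convex_univ (right_comp contF t ht)
      (right_comp (cont (0, e₁, 0)) t ht)
      (fun s _ v _ => ((hX t ht s v).const_mul _).hasDerivWithinAt) (mem_univ r)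
  · refine (continuousOn_setIntegral (F := fun (q : ℝ × ℝ) v => φ v * D (q.1, q.2 • e₁, v) (1, 0))
      (μ := volume) hKv (cont (1, 0))).congr ?_
    exact fun q hq => iT q.1 hq.1 q.2
  · refine (continuousOn_setIntegral
      (F := fun (q : ℝ × ℝ) v => φ v * D (q.1, q.2 • e₁, v) (0, e₁, 0))
      (μ := volume) hKv (cont (0, e₁, 0))).congr ?_
    exact fun q hq => iX q.1 hq.1 q.2

theorem norm_e₁ : ‖e₁‖ = 1 := by simp [e₁]

theorem norm_smul_e₁ {r : ℝ} (hr : 0 ≤ r) : ‖r • e₁‖ = r := by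
  rw [norm_smul, norm_e₁, mul_one, Real.norm_of_nonneg hr]

theorem inner_smul_e₁ (r : ℝ) (v : E3) : inner ℝ (r • e₁) v = r * v 0 := by
  rw [real_inner_smul_left, e₁, EuclideanSpace.inner_single_left]
  simp

theorem inner_div_norm {r : ℝ} (hr : 0 < r) (v : E3) : inner ℝ (r • e₁) v / ‖r • e₁‖ = v 0 := by
  rw [inner_smul_e₁, norm_smul_e₁ hr.le]
  field_simp

theorem rho_eq_moment (t r : ℝ) : rho (f t) r = moment bracket f t r := rfl

theorem j_eq_moment (t : ℝ) {r : ℝ} (hr : 0 < r) : j (f t) r = moment (fun v => v 0) f t r := by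
  simp only [j, jCart, moment, inner_div_norm hr]

theorem p_eq_moment (t : ℝ) {r : ℝ} (hr : 0 < r) :
    p (f t) r = moment (fun v => v 0 ^ 2 / bracket v) f t r := by
  simp only [p, pCart, moment, inner_div_norm hr]
  congr 1
  funext v
  ring

theorem exists_moment_eq_zero (hK : IsCompact K) (h0 : ∀ t ∈ J, ∀ x v, (x, v) ∉ K → f t x v = 0) :
    ∃ R, 0 < R ∧ ∀ φ : E3 → ℝ, ∀ t ∈ J, ∀ r, R ≤ r → moment φ f t r = 0 := by
  obtain ⟨R, hR⟩ := (hK.image continuous_fst).isBounded.exists_norm_le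
  refine ⟨|R| + 1, by positivity, fun φ t ht r hr => ?_⟩
  have hr0 : 0 ≤ r := (by positivity : (0 : ℝ) ≤ |R| + 1).trans hr
  have : ∀ v, f t (r • e₁) v = 0 := fun v => h0 t ht _ v fun hmem => by
    have := hR _ ⟨_, hmem, rfl⟩
    rw [norm_smul_e₁ hr0] at this
    linarith [le_abs_self R]
  simp [moment, this]

end Moments

/-! ### Averages over the radius -/

section Average

variable {J : Set ℝ} {w wt wr : ℝ → ℝ → ℝ}

theorem hasPartials_average (hJ : Convex ℝ J) (hw : HasPartials J (Ici 0) w wt wr) :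
    HasPartials J (Ici 0) (fun t r => ∫ σ in Icc (0 : ℝ) 1, w t (r * σ) * σ ^ 2)
      (fun t r => ∫ σ in Icc (0 : ℝ) 1, wt t (r * σ) * σ ^ 2)
      (fun t r => ∫ σ in Icc (0 : ℝ) 1, wr t (r * σ) * σ * σ ^ 2) := by
  have cw := hw.continuousOn hJ (convex_Ici 0)
  have cont : ∀ {φ : ℝ → ℝ → ℝ}, ContinuousOn (fun q : ℝ × ℝ => φ q.1 q.2) (J ×ˢ Ici 0) →
      ContinuousOn (fun z : (ℝ × ℝ) × ℝ => φ z.1.1 (z.1.2 * z.2)) ((J ×ˢ Ici 0) ×ˢ Icc 0 1) :=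
    fun hφ => hφ.comp (f := fun z : (ℝ × ℝ) × ℝ => (z.1.1, z.1.2 * z.2)) (by fun_prop)
      (fun z hz => ⟨hz.1.1, mul_nonneg hz.1.2 hz.2.1⟩)
  have cw2 : ContinuousOn (fun z : (ℝ × ℝ) × ℝ => w z.1.1 (z.1.2 * z.2) * z.2 ^ 2)
      ((J ×ˢ Ici 0) ×ˢ Icc 0 1) := (cont cw).mul (by fun_prop)
  have ct : ContinuousOn (fun z : (ℝ × ℝ) × ℝ => wt z.1.1 (z.1.2 * z.2) * z.2 ^ 2)
      ((J ×ˢ Ici 0) ×ˢ Icc 0 1) := (cont hw.cont_left).mul (by fun_prop)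
  have cr : ContinuousOn (fun z : (ℝ × ℝ) × ℝ => wr z.1.1 (z.1.2 * z.2) * z.2 * z.2 ^ 2)
      ((J ×ˢ Ici 0) ×ˢ Icc 0 1) := ((cont hw.cont_right).mul (by fun_prop)).mul (by fun_prop)
  have left_comp : ∀ {G : (ℝ × ℝ) × ℝ → ℝ}, ContinuousOn G ((J ×ˢ Ici 0) ×ˢ Icc 0 1) →
      ∀ r ∈ Ici (0 : ℝ), ContinuousOn (fun z : ℝ × ℝ => G ((z.1, r), z.2)) (J ×ˢ Icc 0 1) :=
    fun hG r hr => hG.comp (f := fun z : ℝ × ℝ => ((z.1, r), z.2)) (by fun_prop)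
      (fun z hz => ⟨⟨hz.1, hr⟩, hz.2⟩)
  have right_comp : ∀ {G : (ℝ × ℝ) × ℝ → ℝ}, ContinuousOn G ((J ×ˢ Ici 0) ×ˢ Icc 0 1) →
      ∀ t ∈ J, ContinuousOn (fun z : ℝ × ℝ => G ((t, z.1), z.2)) (Ici 0 ×ˢ Icc 0 1) :=
    fun hG t ht => hG.comp (f := fun z : ℝ × ℝ => ((t, z.1), z.2)) (by fun_prop)
      (fun z hz => ⟨⟨ht, hz.1⟩, hz.2⟩)
  refine ⟨fun t ht r hr => ?_, fun t ht r hr => ?_, continuousOn_setIntegral isCompact_Icc ct,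
    continuousOn_setIntegral isCompact_Icc cr⟩
  · exact hasDerivWithinAt_setIntegral (F := fun s σ => w s (r * σ) * σ ^ 2)
      (F' := fun s σ => wt s (r * σ) * σ ^ 2) isCompact_Icc hJ (left_comp cw2 r hr)
      (left_comp ct r hr)
      (fun s hs σ hσ => (hw.left s hs _ (mul_nonneg hr hσ.1)).mul_const _) ht
  · refine hasDerivWithinAt_setIntegral (F := fun r σ => w t (r * σ) * σ ^ 2)
      (F' := fun r σ => wr t (r * σ) * σ * σ ^ 2) isCompact_Icc (convex_Ici 0)
      (right_comp cw2 t ht) (right_comp cr t ht) (fun y hy σ hσ => ?_) hr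
    have h1 : HasDerivWithinAt (fun y => y * σ) σ (Ici 0) y := by
      simpa using (hasDerivWithinAt_id y (Ici 0)).mul_const σ
    exact ((hw.right t ht _ (mul_nonneg hy hσ.1)).comp y h1
      (fun z hz => mul_nonneg hz hσ.1)).mul_const _

theorem integral_mul_sq_eq_average (φ : ℝ → ℝ) (r : ℝ) :
    ∫ s in (0 : ℝ)..r, φ s * s ^ 2 = r ^ 3 * ∫ σ in Icc (0 : ℝ) 1, φ (r * σ) * σ ^ 2 := by
  rw [intervalIntegral_eq_mul_setIntegral, sub_zero]
  simp only [zero_add]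
  rw [← integral_const_mul, ← integral_const_mul]
  congr 1
  funext σ
  ring

end Average

section Products

variable {J R : Set ℝ} {g gt gr k kt kr : ℝ → ℝ → ℝ}

theorem HasPartials.mul (hJ : Convex ℝ J) (hR : Convex ℝ R) (hg : HasPartials J R g gt gr)
    (hk : HasPartials J R k kt kr) :
    HasPartials J R (fun t r => g t r * k t r) (fun t r => gt t r * k t r + g t r * kt t r)
      (fun t r => gr t r * k t r + g t r * kr t r) where
  left t ht r hr := (hg.left t ht r hr).fun_mul (hk.left t ht r hr)
  right t ht r hr := (hg.right t ht r hr).fun_mul (hk.right t ht r hr)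
  cont_left := (hg.cont_left.mul (hk.continuousOn hJ hR)).add
    ((hg.continuousOn hJ hR).mul hk.cont_left)
  cont_right := (hg.cont_right.mul (hk.continuousOn hJ hR)).add
    ((hg.continuousOn hJ hR).mul hk.cont_right)

theorem HasPartials.inv (hJ : Convex ℝ J) (hR : Convex ℝ R) (hg : HasPartials J R g gt gr)
    (h0 : ∀ t ∈ J, ∀ r ∈ R, g t r ≠ 0) :
    HasPartials J R (fun t r => (g t r)⁻¹) (fun t r => -gt t r / g t r ^ 2)
      (fun t r => -gr t r / g t r ^ 2) where
  left t ht r hr := (hg.left t ht r hr).fun_inv (h0 t ht r hr)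
  right t ht r hr := (hg.right t ht r hr).fun_inv (h0 t ht r hr)
  cont_left := hg.cont_left.neg.div ((hg.continuousOn hJ hR).pow 2)
    fun q hq => pow_ne_zero 2 (h0 q.1 hq.1 q.2 hq.2)
  cont_right := hg.cont_right.neg.div ((hg.continuousOn hJ hR).pow 2)
    fun q hq => pow_ne_zero 2 (h0 q.1 hq.1 q.2 hq.2)

theorem hasPartials_const_mul_radius (c : ℝ) :
    HasPartials J R (fun _ r => c * r) (fun _ _ => 0) (fun _ _ => c) where
  left t _ r _ := hasDerivWithinAt_const t J (c * r)
  right _ _ r _ := by simpa using (hasDerivWithinAt_id r R).const_mul c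
  cont_left := continuousOn_const
  cont_right := continuousOn_const

end Products

/-! ### The time interval -/

section TimeInterval

variable {T : EReal}

theorem Icc_subset_timeInterval {T₁ : ℝ} (h : T₁ ∈ timeInterval T) : Icc 0 T₁ ⊆ timeInterval T :=
  fun _ hs => ⟨hs.1, (EReal.coe_le_coe_iff.2 hs.2).trans_lt h.2⟩

theorem exists_gt_mem_timeInterval {t : ℝ} (h : t ∈ timeInterval T) :
    ∃ T₁ ∈ timeInterval T, t < T₁ := by
  obtain ⟨T₁, h1, h2⟩ := EReal.lt_iff_exists_real_btwn.1 h.2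
  have h1' := EReal.coe_lt_coe_iff.1 h1
  exact ⟨T₁, ⟨h.1.trans h1'.le, h2⟩, h1'⟩

theorem uniqueDiffOn_timeInterval : UniqueDiffOn ℝ (timeInterval T) := by
  intro t ht
  obtain ⟨T₁, hT₁, hlt⟩ := exists_gt_mem_timeInterval ht
  exact (uniqueDiffOn_Icc (ht.1.trans_lt hlt) t ⟨ht.1, hlt.le⟩).mono (Icc_subset_timeInterval hT₁)

theorem smoothTR_of_Icc {n : ℕ} {g : ℝ → ℝ → ℝ}
    (h : ∀ T₁ ∈ timeInterval T, 0 < T₁ → SmoothTR n (Icc 0 T₁) g) :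
    SmoothTR n (timeInterval T) g := by
  rintro ⟨t, r⟩ ⟨ht, hr⟩
  obtain ⟨T₁, hT₁, hlt⟩ := exists_gt_mem_timeInterval ht
  refine (h T₁ hT₁ (ht.1.trans_lt hlt) (t, r) ⟨⟨ht.1, hlt.le⟩, hr⟩).mono_of_mem_nhdsWithin ?_
  rw [nhdsWithin_prod_eq]
  refine prod_mem_prod ?_ self_mem_nhdsWithin
  filter_upwards [self_mem_nhdsWithin, mem_nhdsWithin_of_mem_nhds (Iic_mem_nhds hlt)] with s hs hs'
  exact ⟨hs.1, hs'⟩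

theorem SmoothTR.hasPartials {g : ℝ → ℝ → ℝ} (h : SmoothTR 1 (timeInterval T) g) :
    HasPartials (timeInterval T) (Ici 0) g (dt (timeInterval T) g) (dr g) :=
  hasPartials_of_contDiffOn uniqueDiffOn_timeInterval (uniqueDiffOn_Ici 0)
    (by simpa [SmoothTR] using h)

end TimeInterval

/-! ### Regular solutions on compact time intervals -/

section Solution

variable {T : EReal} {T₁ : ℝ} {f₀ : E3 → E3 → ℝ} {a₀ b₀ : ℝ → ℝ} {f : ℝ → E3 → E3 → ℝ}
  {a b : ℝ → ℝ → ℝ}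

theorem continuous_coord (i : Fin 3) : Continuous fun v : E3 => v i := by fun_prop

theorem continuous_pressure_weight : Continuous fun v : E3 => v 0 ^ 2 / bracket v :=
  ((continuous_coord 0).pow 2).div continuous_bracket fun v => (bracket_pos v).ne'

theorem continuous_inv_bracket : Continuous fun v : E3 => (bracket v)⁻¹ :=
  continuous_bracket.inv₀ fun v => (bracket_pos v).ne'

/-- `ρ - a β j`, with `ρ` and `j` the moments on the ray spanned by `e₁`. -/
noncomputable def massDensity (f : ℝ → E3 → E3 → ℝ) (a b : ℝ → ℝ → ℝ) (t r : ℝ) : ℝ :=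
  moment bracket f t r - a t r * b t r * moment (fun v => v 0) f t r

/-- The right hand side of the equation for `β`, in a form that is regular at the center. -/
noncomputable def betaSource (f : ℝ → E3 → E3 → ℝ) (a b : ℝ → ℝ → ℝ) (t r : ℝ) : ℝ :=
  4 * Real.pi * r * ((∫ σ in Icc (0 : ℝ) 1, massDensity f a b t (r * σ) * σ ^ 2) +
    moment (fun v => v 0 ^ 2 / bracket v) f t r)

theorem capA_eq (t : ℝ) {r : ℝ} (hr : 0 < r) : 1 / (2 * r) * (1 - capA (f t) (a t) (b t) r) =
    4 * Real.pi * r * ∫ σ in Icc (0 : ℝ) 1, massDensity f a b t (r * σ) * σ ^ 2 := by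
  have h : ∫ s in (0 : ℝ)..r, (rho (f t) s - a t s * b t s * j (f t) s) * s ^ 2 =
      ∫ s in (0 : ℝ)..r, massDensity f a b t s * s ^ 2 := by
    refine intervalIntegral.integral_congr fun s hs => ?_
    rw [uIcc_of_le hr.le] at hs
    rcases hs.1.eq_or_lt with h0 | h0
    · simp [← h0]
    · simp only [massDensity, rho_eq_moment, j_eq_moment t h0]
  rw [capA, h, integral_mul_sq_eq_average]
  field_simp
  ring

theorem IsRegularSolution.eq_betaSource (hsol : IsRegularSolution T f₀ a₀ b₀ f a b) {t r : ℝ}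
    (ht : t ∈ timeInterval T) (hr : 0 ≤ r) :
    dt (timeInterval T) b t r - b t r * dr b t r = betaSource f a b t r := by
  rcases hr.eq_or_lt with h0 | h0
  · subst h0
    have h1 : dt (timeInterval T) b t 0 = 0 := by
      rw [dt, derivWithin_congr (f := fun _ => (0 : ℝ))
        (fun s hs => hsol.regular_b.center s hs) (hsol.regular_b.center t ht)]
      simp
    simp [h1, hsol.regular_b.center t ht, betaSource]
  · rw [hsol.eq_b t ht r h0, capA_eq t h0, p_eq_moment t h0, betaSource]
    ring

theorem IsRegularSolution.eq_a_moment (hsol : IsRegularSolution T f₀ a₀ b₀ f a b) {t r : ℝ}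
    (ht : t ∈ timeInterval T) (hr : 0 ≤ r) :
    dt (timeInterval T) a t r - b t r * dr a t r =
      -(4 * Real.pi * r * a t r ^ 2 * moment (fun v => v 0) f t r) := by
  rw [hsol.eq_a t ht r hr]
  rcases hr.eq_or_lt with h0 | h0
  · simp [← h0]
  · rw [j_eq_moment t h0]

theorem IsRegularF.contDiffOn_Icc (hf : IsRegularF (timeInterval T) f)
    (hT₁ : T₁ ∈ timeInterval T) :
    ContDiffOn ℝ 1 (fun q : ℝ × E3 × E3 => f q.1 q.2.1 q.2.2) (Icc 0 T₁ ×ˢ univ) :=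
  hf.contDiff.mono (prod_mono (Icc_subset_timeInterval hT₁) subset_rfl)

theorem IsRegularF.hasPartials_moment (hf : IsRegularF (timeInterval T) f)
    (hT₁ : T₁ ∈ timeInterval T) (hpos : 0 < T₁) {φ : E3 → ℝ} (hφ : Continuous φ) :
    HasPartials (Icc 0 T₁) (Ici 0) (moment φ f)
      (fun t r => ∫ v, φ v * derivWithin (fun s => f s (r • e₁) v) (Icc 0 T₁) t)
      (fun t r => ∫ v, φ v * fderiv ℝ (fun y => f t y v) (r • e₁) e₁) := by
  obtain ⟨K, hK, h0⟩ := hf.compact (Icc 0 T₁) (Icc_subset_timeInterval hT₁) isCompact_Icc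
  exact (EinsteinVlasov.hasPartials_moment (convex_Icc 0 T₁) (uniqueDiffOn_Icc hpos)
    (hf.contDiffOn_Icc hT₁) hK h0 hφ).mono subset_rfl (subset_univ _)

theorem IsRegularF.contDiffOn_moment (hf : IsRegularF (timeInterval T) f)
    (hT₁ : T₁ ∈ timeInterval T) (hpos : 0 < T₁) {φ : E3 → ℝ} (hφ : Continuous φ) :
    ContDiffOn ℝ 1 (fun q : ℝ × ℝ => moment φ f q.1 q.2) (Icc 0 T₁ ×ˢ Ici 0) :=
  (hf.hasPartials_moment hT₁ hpos hφ).contDiffOn_one (convex_Icc 0 T₁) (convex_Ici 0)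
    (uniqueDiffOn_Icc hpos) (uniqueDiffOn_Ici 0)

theorem SmoothTR.contDiffOn_Icc {g : ℝ → ℝ → ℝ} (h : SmoothTR 1 (timeInterval T) g)
    (hT₁ : T₁ ∈ timeInterval T) :
    ContDiffOn ℝ 1 (fun q : ℝ × ℝ => g q.1 q.2) (Icc 0 T₁ ×ˢ Ici 0) := by
  have h' : ContDiffOn ℝ 1 (fun q : ℝ × ℝ => g q.1 q.2) (timeInterval T ×ˢ Ici 0) := by
    simpa [SmoothTR] using h
  exact h'.mono (prod_mono (Icc_subset_timeInterval hT₁) subset_rfl)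

theorem SmoothTR.hasPartials_Icc {g : ℝ → ℝ → ℝ} (h : SmoothTR 1 (timeInterval T) g)
    (hT₁ : T₁ ∈ timeInterval T) :
    HasPartials (Icc 0 T₁) (Ici 0) g (dt (timeInterval T) g) (dr g) :=
  h.hasPartials.mono (Icc_subset_timeInterval hT₁) subset_rfl

theorem IsRegularSolution.contDiffOn_massDensity (hsol : IsRegularSolution T f₀ a₀ b₀ f a b)
    (hT₁ : T₁ ∈ timeInterval T) (hpos : 0 < T₁) :
    ContDiffOn ℝ 1 (fun q : ℝ × ℝ => massDensity f a b q.1 q.2) (Icc 0 T₁ ×ˢ Ici 0) :=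
  (hsol.regular_f.contDiffOn_moment hT₁ hpos continuous_bracket).sub
    (((hsol.regular_a.contDiff.contDiffOn_Icc hT₁).mul
      (hsol.regular_b.contDiff.contDiffOn_Icc hT₁)).mul
      (hsol.regular_f.contDiffOn_moment hT₁ hpos (continuous_coord 0)))

theorem IsRegularSolution.contDiffOn_betaSource (hsol : IsRegularSolution T f₀ a₀ b₀ f a b)
    (hT₁ : T₁ ∈ timeInterval T) (hpos : 0 < T₁) :
    ContDiffOn ℝ 1 (fun q : ℝ × ℝ => betaSource f a b q.1 q.2) (Icc 0 T₁ ×ˢ Ici 0) := by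
  have h1 := (hasPartials_average (convex_Icc 0 T₁) (hasPartials_of_contDiffOn
    (uniqueDiffOn_Icc hpos) (uniqueDiffOn_Ici 0)
    (hsol.contDiffOn_massDensity hT₁ hpos))).contDiffOn_one (convex_Icc 0 T₁) (convex_Ici 0)
    (uniqueDiffOn_Icc hpos) (uniqueDiffOn_Ici 0)
  have h2 := hsol.regular_f.contDiffOn_moment hT₁ hpos continuous_pressure_weight
  have h3 : ContDiffOn ℝ 1 (fun q : ℝ × ℝ => 4 * Real.pi * q.2) (Icc 0 T₁ ×ˢ Ici 0) := by
    fun_prop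
  exact h3.mul (h1.add h2)

theorem IsRegularSolution.contDiffOn_two_b (hsol : IsRegularSolution T f₀ a₀ b₀ f a b)
    (hT₁ : T₁ ∈ timeInterval T) (hpos : 0 < T₁) : SmoothTR 2 (Icc 0 T₁) b := by
  have hb := hsol.regular_b.contDiff.contDiffOn_Icc hT₁
  have hbr := hsol.regular_b.contDiff_dr.contDiffOn_Icc hT₁
  have hbt : ContDiffOn ℝ 1 (fun q : ℝ × ℝ => dt (timeInterval T) b q.1 q.2)
      (Icc 0 T₁ ×ˢ Ici 0) := by
    refine ((hsol.contDiffOn_betaSource hT₁ hpos).add (hb.mul hbr)).congr fun q hq => ?_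
    have := hsol.eq_betaSource (Icc_subset_timeInterval hT₁ hq.1) hq.2
    simp only [← this]
    ring
  exact (hsol.regular_b.contDiff.hasPartials_Icc hT₁).contDiffOn (n := 1) (convex_Icc 0 T₁)
    (convex_Ici 0) (uniqueDiffOn_Icc hpos) (uniqueDiffOn_Ici 0) (by exact_mod_cast hbt)
    (by exact_mod_cast hbr)

theorem IsRegularSolution.exists_betaSource_bound (hsol : IsRegularSolution T f₀ a₀ b₀ f a b)
    (hT₁ : T₁ ∈ timeInterval T) (hpos : 0 < T₁) :
    ∃ C, ∀ t ∈ Icc 0 T₁, ∀ r ∈ Ici (0 : ℝ), |betaSource f a b t r| ≤ C := by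
  obtain ⟨K, hK, h0⟩ := hsol.regular_f.compact (Icc 0 T₁) (Icc_subset_timeInterval hT₁)
    isCompact_Icc
  obtain ⟨R, hR, hM⟩ := exists_moment_eq_zero hK h0
  obtain ⟨C, -, hC⟩ := exists_abs_le (r := R) (hsol.contDiffOn_betaSource hT₁ hpos).continuousOn
  refine ⟨C, fun t ht r hr => ?_⟩
  rcases le_total r R with hrR | hrR
  · exact hC t ht r ⟨hr, hrR⟩
  refine le_trans ?_ (hC t ht R ⟨hR.le, le_rfl⟩)
  have hr0 : 0 < r := hR.trans_le hrR
  set φ : ℝ → ℝ := massDensity f a b t with hφ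
  have hφ0 : ∀ s, R ≤ s → φ s = 0 := fun s hs => by
    simp [hφ, massDensity, hM _ t ht s hs]
  have cφ : ContinuousOn (fun s => φ s * s ^ 2) (Ici 0) :=
    (slice_right (hsol.contDiffOn_massDensity hT₁ hpos).continuousOn ht).mul (by fun_prop)
  have hint : ∫ s in (0 : ℝ)..r, φ s * s ^ 2 = ∫ s in (0 : ℝ)..R, φ s * s ^ 2 := by
    rw [← intervalIntegral.integral_add_adjacent_intervals (b := R)]
    · have : ∫ s in R..r, φ s * s ^ 2 = ∫ s in R..r, (0 : ℝ) := by
        refine intervalIntegral.integral_congr fun s hs => ?_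
        rw [uIcc_of_le hrR] at hs
        simp [hφ0 s hs.1]
      rw [this]
      simp
    · refine (cφ.mono ?_).intervalIntegrable
      rw [uIcc_of_le hR.le]
      exact Icc_subset_Ici_self
    · refine (cφ.mono ?_).intervalIntegrable
      rw [uIcc_of_le hrR]
      exact fun s hs => hR.le.trans hs.1
  rw [integral_mul_sq_eq_average, integral_mul_sq_eq_average] at hint
  have e1 : betaSource f a b t r = (R / r) ^ 2 * betaSource f a b t R := by
    simp only [betaSource, hM _ t ht r hrR, hM _ t ht R le_rfl, add_zero]
    rw [← hφ]
    generalize (∫ σ in Icc (0 : ℝ) 1, φ (r * σ) * σ ^ 2) = A at hint ⊢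
    generalize (∫ σ in Icc (0 : ℝ) 1, φ (R * σ) * σ ^ 2) = B at hint ⊢
    field_simp
    linear_combination hint
  rw [e1, abs_mul, abs_of_nonneg (by positivity)]
  exact mul_le_of_le_one_left (abs_nonneg _)
    (pow_le_one₀ (by positivity) ((div_le_one hr0).2 hrR))

/-- The equation for `∂_t ρ` that results from the Vlasov equation. -/
theorem IsRegularSolution.energy_equation (hsol : IsRegularSolution T f₀ a₀ b₀ f a b)
    (hT₁ : T₁ ∈ timeInterval T) (hpos : 0 < T₁) {t r : ℝ} (ht : t ∈ Icc 0 T₁) (hr : 0 < r) :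
    ∫ v, bracket v * derivWithin (fun s => f s (r • e₁) v) (Icc 0 T₁) t =
      b t r * (∫ v, bracket v * fderiv ℝ (fun y => f t y v) (r • e₁) e₁) -
      1 / a t r * ((∫ v, v 0 * fderiv ℝ (fun y => f t y v) (r • e₁) e₁) +
        2 / r * moment (fun v => v 0) f t r) +
      (4 * Real.pi * r * a t r * moment (fun v => v 0) f t r + dr b t r - b t r / r) *
        (moment bracket f t r + moment (fun v => v 0 ^ 2 / bracket v) f t r) +
      b t r / r * (4 * moment bracket f t r - moment (fun v => (bracket v)⁻¹) f t r) := by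
  have htI := Icc_subset_timeInterval hT₁ ht
  obtain ⟨K, hK, h0⟩ := hsol.regular_f.compact (Icc 0 T₁) (Icc_subset_timeInterval hT₁)
    isCompact_Icc
  refine energy_balance hK (h0 t ht) (contDiff_slice hsol.regular_f.contDiff htI)
    (hsol.regular_f.symm t htI) hr fun v => ?_
  have hx : r • e₁ ≠ 0 := by
    rw [← norm_pos_iff, norm_smul_e₁ hr.le]
    exact hr
  have hV := hsol.vlasov t htI (r • e₁) v hx
  have hd := hasDerivWithinAt_time hsol.regular_f.contDiff htI (r • e₁) v
  rw [(hd.mono (Icc_subset_timeInterval hT₁)).derivWithin (uniqueDiffOn_Icc hpos t ht),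
    ← hd.derivWithin (uniqueDiffOn_timeInterval t htI)]
  have e1 : F1 a b t (r • e₁) v = (1 / a t r / bracket v) • v - b t r • e₁ := by
    rw [F1, norm_smul_e₁ hr.le, smul_smul, div_mul_cancel₀ _ hr.ne', div_div]
  have e2 : F2 f a b t (r • e₁) v =
      ((4 * Real.pi * r * a t r * moment (fun v => v 0) f t r + dr b t r - b t r / r) * v 0) • e₁ +
        (b t r / r) • v := by
    rw [F2, inner_div_norm hr, norm_smul_e₁ hr.le, smul_smul, smul_smul, ← add_smul,
      j_eq_moment t hr]
    congr 2
    field_simp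
    ring
  rw [e1, e2] at hV
  exact hV

theorem IsRegularSolution.contDiffOn_two_a (hsol : IsRegularSolution T f₀ a₀ b₀ f a b)
    (ha₀ : ContDiffOn ℝ 2 a₀ (Ici 0)) (hT₁ : T₁ ∈ timeInterval T) (hpos : 0 < T₁) :
    SmoothTR 2 (Icc 0 T₁) a := by
  have hsub := Icc_subset_timeInterval hT₁
  have cJ : Convex ℝ (Icc 0 T₁) := convex_Icc 0 T₁
  have cR : Convex ℝ (Ici (0 : ℝ)) := convex_Ici 0
  have uJ := uniqueDiffOn_Icc hpos
  have uR := uniqueDiffOn_Ici (0 : ℝ)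
  have h0J : (0 : ℝ) ∈ Icc 0 T₁ := ⟨le_rfl, hpos.le⟩
  have ha := hsol.regular_a.contDiff.hasPartials_Icc hT₁
  have hb := hsol.regular_b.contDiff.hasPartials_Icc hT₁
  have hbr := hsol.regular_b.contDiff_dr.hasPartials_Icc hT₁
  have sa := hsol.regular_a.contDiff.contDiffOn_Icc hT₁
  have sb := hsol.regular_b.contDiff.contDiffOn_Icc hT₁
  have sbr := hsol.regular_b.contDiff_dr.contDiffOn_Icc hT₁
  have apos : ∀ t ∈ Icc 0 T₁, ∀ r ∈ Ici (0 : ℝ), a t r ≠ 0 := fun t ht r hr =>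
    (hsol.regular_a.pos t (hsub ht) r hr).ne'
  obtain ⟨C, hC⟩ := hsol.exists_betaSource_bound hT₁ hpos
  have hρ := hsol.regular_f.hasPartials_moment hT₁ hpos continuous_bracket
  have hj := hsol.regular_f.hasPartials_moment hT₁ hpos (continuous_coord 0)
  have sρ := hsol.regular_f.contDiffOn_moment hT₁ hpos continuous_bracket
  have sj := hsol.regular_f.contDiffOn_moment hT₁ hpos (continuous_coord 0)
  have sp := hsol.regular_f.contDiffOn_moment hT₁ hpos continuous_pressure_weight
  have sn := hsol.regular_f.contDiffOn_moment hT₁ hpos continuous_inv_bracket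
  have hu := ha.inv cJ cR apos
  have hrad := hasPartials_const_mul_radius (J := Icc 0 T₁) (R := Ici 0) (4 * Real.pi)
  have hg := hrad.mul cJ cR hj
  have hk := hrad.mul cJ cR (ha.mul cJ cR hρ)
  set h : ℝ → ℝ → ℝ := fun t r => 4 * Real.pi * (-moment (fun v => v 0) f t r +
    a t r * b t r * (2 * moment bracket f t r - moment (fun v => v 0 ^ 2 / bracket v) f t r -
      moment (fun v => (bracket v)⁻¹) f t r) +
    4 * Real.pi * r ^ 2 * a t r ^ 2 * moment (fun v => v 0) f t r *
      moment (fun v => v 0 ^ 2 / bracket v) f t r +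
    a t r * r * dr b t r *
      (moment bracket f t r + moment (fun v => v 0 ^ 2 / bracket v) f t r)) with hh_def
  have sh : ContDiffOn ℝ 1 (fun q : ℝ × ℝ => h q.1 q.2) (Icc 0 T₁ ×ˢ Ici 0) := by
    simp only [hh_def]
    fun_prop
  have hh := hasPartials_of_contDiffOn uJ uR sh
  have hQ : ContDiffOn ℝ 1 (fun y => -dr a 0 y / a 0 y ^ 2 +
      4 * Real.pi * y * (a 0 y * moment bracket f 0 y)) (Ici 0) := by
    have q1 : ContDiffOn ℝ 1 (dr a 0) (Ici 0) := by
      refine (ha₀.derivWithin uR (m := 1) (by norm_num)).congr fun y hy => ?_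
      exact derivWithin_congr (fun z hz => hsol.init_a z hz) (hsol.init_a y hy)
    have q2 : ContDiffOn ℝ 1 (a 0) (Ici 0) :=
      (ha₀.of_le (by norm_num)).congr fun y hy => hsol.init_a y hy
    have q3 : ContDiffOn ℝ 1 (moment bracket f 0) (Ici 0) :=
      sρ.comp (f := fun y : ℝ => ((0 : ℝ), y)) (by fun_prop) (fun y hy => ⟨h0J, hy⟩)
    have q4 : ContDiffOn ℝ 1 (fun y : ℝ => 4 * Real.pi * y) (Ici 0) := by fun_prop
    exact (q1.neg.div (q2.pow 2) fun y hy => pow_ne_zero 2 (apos 0 h0J y hy)).add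
      (q4.mul (q2.mul q3))
  have cg := hg.cont_right
  have cD := ((hk.cont_left.sub ((hb.continuousOn cJ cR).mul hk.cont_right)).neg).add
    (hh.continuousOn cJ cR)
  have key := contDiffOn_two_of_transport hpos hb hbr
    (fun t ht => hsol.regular_b.center t (hsub ht)) (K := C)
    (fun t ht r hr => by
      rw [hsol.eq_betaSource (hsub ht) hr]
      exact hC t ht r hr) hu hg hk hh
    (Q' := derivWithin (fun y => -dr a 0 y / a 0 y ^ 2 +
      4 * Real.pi * y * (a 0 y * moment bracket f 0 y)) (Ici 0)) ?_ ?_ ?_ ?_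
  · refine (key.inv fun q hq => inv_ne_zero (apos q.1 hq.1 q.2 hq.2)).congr fun q _ => ?_
    simp
  · intro t ht r hr
    have := hsol.eq_a_moment (hsub ht) hr
    have ha0 := apos t ht r hr
    field_simp
    linarith
  · intro t ht
    have hslice : MapsTo (fun r : ℝ => (t, r)) (Ici 0) (Icc 0 T₁ ×ˢ Ici 0) := fun r hr => ⟨ht, hr⟩
    refine EqOn.of_subset_closure (s := Ioi (0 : ℝ)) ?_ (cg.comp (by fun_prop) hslice)
      (cD.comp (by fun_prop) hslice) Ioi_subset_Ici_self (by rw [closure_Ioi])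
    intro r hr
    have hr0 : 0 < r := hr
    have e1 := hsol.energy_equation hT₁ hpos ht hr0
    have e2 := hsol.eq_a_moment (hsub ht) hr0.le
    have ha0 := apos t ht r hr0.le
    have e3 : dt (timeInterval T) a t r = b t r * dr a t r -
      4 * Real.pi * r * a t r ^ 2 * moment (fun v => v 0) f t r := by linarith
    simp only [e1, e3, hh_def]
    field_simp
    ring
  · exact fun r hr => (hQ.differentiableOn one_ne_zero r hr).hasDerivWithinAt
  · exact hQ.continuousOn_derivWithin uR le_rfl

end Solution

end EinsteinVlasov

theorem corollary4p1 (T : EReal) (hT : 0 < T)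
    (f₀ : EinsteinVlasov.E3 → EinsteinVlasov.E3 → ℝ) (a₀ b₀ : ℝ → ℝ)
    (hdata : EinsteinVlasov.IsAdmissibleData f₀ a₀ b₀)
    (ha₀ : ContDiffOn ℝ 2 a₀ (Set.Ici 0))
    (f : ℝ → EinsteinVlasov.E3 → EinsteinVlasov.E3 → ℝ) (a b : ℝ → ℝ → ℝ)
    (hsol : EinsteinVlasov.IsRegularSolution T f₀ a₀ b₀ f a b) :
    EinsteinVlasov.SmoothTR 2 (EinsteinVlasov.timeInterval T) a ∧
      EinsteinVlasov.SmoothTR 2 (EinsteinVlasov.timeInterval T) b := by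
  exact ⟨EinsteinVlasov.smoothTR_of_Icc fun _ h1 h2 => hsol.contDiffOn_two_a ha₀ h1 h2,
    EinsteinVlasov.smoothTR_of_Icc fun _ h1 h2 => hsol.contDiffOn_two_b h1 h2⟩
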